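/- Let $L,T>0$. Let $H^1_{0,}(0,T)=\{v\in H^1(0,T): v(0)=0\}$ and $H^1_{,0}(0,T)=\{v\in H^1(0,T): v(T)=0\}$ (real-valued functions), both normed by $\|\partial_t v\|_{L^2(0,T)}$, and let $H^{1/2}_{0,}(0,T):=[H^1_{0,}(0,T),L^2(0,T)]_{1/2}$ and $H^{1/2}_{,0}(0,T):=[H^1_{,0}(0,T),L^2(0,T)]_{1/2}$ be the Hilbert interpolation spaces, with norm $\|u\|^2=\frac{2}{\pi}\int_0^\infty s^{-2}K(s,u)^2\,ds$, where $K(s,u)^2=\inf_{v}\big(\|u-v\|_{L^2(0,T)}^2+s^2\|\partial_t v\|_{L^2(0,T)}^2\big)$ and $v$ ranges over the respective $H^1$ space. Put $L^2(\Sigma)=L^2(0,T)^2$, $H^{1/2}_{0,}(\Sigma)=H^{1/2}_{0,}(0,T)^2$, $H^{1/2}_{,0}(\Sigma)=H^{1/2}_{,0}(0,T)^2$, with the norms $\|(z_0,z_L)\|=(\|z_0\|^2+\|z_L\|^2)^{1/2}$. Write $[\,\cdot\,]'$ for the dual space with the dual norm, $\langle\cdot,\cdot\rangle_\Sigma$ for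 the duality pairing extending the inner product of $L^2(\Sigma)$, and embed $L^2(\Sigma)$ in $[H^{1/2}_{,0}(\Sigma)]'$ through this pairing. For $w=(w_0,w_L)\in L^2(\Sigma)$, extended by zero outside $(0,T)$, the single layer boundary integral operator $V$ of the one-dimensional wave equation is $$ (Vw)(t)=\begin{pmatrix}\tfrac12\int_0^t w_0(s)\,ds+\tfrac12\int_0^{t-L}w_L(s)\,ds\\[1mm] \tfrac12\int_0^{t-L} w_0(s)\,ds+\tfrac12\int_0^{t}w_L(s)\,ds\end{pmatrix},\qquad t\in(0,T).$$ Then $V$ has a unique extension to a bounded linear operator $$V:[H^{1/2}_{,0}(\Sigma)]'\to H^{1/2}_{0,}(\Sigma),$$ and this operator is an isomorphism (a linear bijection, bounded with bounded inverse). Moreover there is a constant $c_S>0$ such that $$ c_S\,\|w\|_{[H^{1/2}_{,0}(\Sigma)]'}\le\sup_{0\neq v\in[H^{1/2}_{0,}(\Sigma)]'}\frac{|\langle Vw,v\rangle_\Sigma|}{\|v\|_{[H^{1/2}_{0,}(\Sigma)]'}}\qquad\text{for all } w\in[H^{1/2}_{,0}(\Sigma)]'.$$ -/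

import Mathlib

open MeasureTheory Set
open scoped ContDiff

namespace HalfInterp

section

variable {X Y : Type*} [NormedAddCommGroup X] [NormedSpace ℝ X]
  [NormedAddCommGroup Y] [NormedSpace ℝ Y]

/-- The quadratic `K`-functional of a pair of spaces `X ↪ Y` with embedding `j`:
`K(s, y) = inf_{x ∈ X} (‖y - j x‖_Y² + s² ‖x‖_X²)^{1/2}`. -/
noncomputable def kFun (j : X →L[ℝ] Y) (s : ℝ) (y : Y) : ℝ :=
  ⨅ x : X, √(‖y - j x‖ ^ 2 + s ^ 2 * ‖x‖ ^ 2)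

theorem kFun_bddBelow (j : X →L[ℝ] Y) (s : ℝ) (y : Y) :
    BddBelow (range fun x : X => √(‖y - j x‖ ^ 2 + s ^ 2 * ‖x‖ ^ 2)) :=
  ⟨0, by rintro _ ⟨x, rfl⟩; positivity⟩

theorem kFun_nonneg (j : X →L[ℝ] Y) (s : ℝ) (y : Y) : 0 ≤ kFun j s y :=
  Real.iInf_nonneg fun _ => Real.sqrt_nonneg _

theorem kFun_le (j : X →L[ℝ] Y) (s : ℝ) (y : Y) (x : X) :
    kFun j s y ≤ √(‖y - j x‖ ^ 2 + s ^ 2 * ‖x‖ ^ 2) :=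
  ciInf_le (kFun_bddBelow j s y) x

theorem kFun_zero (j : X →L[ℝ] Y) (s : ℝ) : kFun j s 0 = 0 :=
  le_antisymm (by simpa using kFun_le j s 0 0) (kFun_nonneg j s 0)

theorem sqrt_add_sq_le {a b c d p q : ℝ} (hp : 0 ≤ p) (hq : 0 ≤ q) (h1 : p ≤ a + c)
    (h2 : q ≤ b + d) : √(p ^ 2 + q ^ 2) ≤ √(a ^ 2 + b ^ 2) + √(c ^ 2 + d ^ 2) := by
  have hA : 0 ≤ a ^ 2 + b ^ 2 := by positivity
  have hC : 0 ≤ c ^ 2 + d ^ 2 := by positivity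
  have hcs : a * c + b * d ≤ √(a ^ 2 + b ^ 2) * √(c ^ 2 + d ^ 2) := by
    rw [← Real.sqrt_mul hA]
    exact Real.le_sqrt_of_sq_le (by nlinarith [sq_nonneg (a * d - b * c)])
  apply Real.sqrt_le_iff.mpr
  refine ⟨by positivity, ?_⟩
  have e1 : p ^ 2 ≤ (a + c) ^ 2 := by gcongr
  have e2 : q ^ 2 ≤ (b + d) ^ 2 := by gcongr
  nlinarith [Real.sq_sqrt hA, Real.sq_sqrt hC]

theorem kFun_add_le (j : X →L[ℝ] Y) (s : ℝ) (y z : Y) :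
    kFun j s (y + z) ≤ kFun j s y + kFun j s z := by
  refine le_ciInf_add_ciInf fun a b => ?_
  refine (kFun_le j s (y + z) (a + b)).trans ?_
  have h := sqrt_add_sq_le (a := ‖y - j a‖) (c := ‖z - j b‖) (b := |s| * ‖a‖) (d := |s| * ‖b‖)
    (p := ‖y + z - j (a + b)‖) (q := |s| * ‖a + b‖) (by positivity) (by positivity)
    (by rw [map_add, add_sub_add_comm]; exact norm_add_le _ _)
    (by rw [← mul_add]; gcongr; exact norm_add_le _ _)
  simpa only [mul_pow, sq_abs] using h

theorem kFun_smul_le (j : X →L[ℝ] Y) (s c : ℝ) (y : Y) :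
    kFun j s (c • y) ≤ |c| * kFun j s y := by
  unfold kFun
  rw [Real.mul_iInf_of_nonneg (abs_nonneg c)]
  refine le_ciInf fun x => (kFun_le j s (c • y) (c • x)).trans (le_of_eq ?_)
  rw [map_smul, ← smul_sub, norm_smul, norm_smul, Real.norm_eq_abs, ← Real.sqrt_sq (abs_nonneg c),
    ← Real.sqrt_mul (sq_nonneg _), Real.sqrt_sq (abs_nonneg c)]
  congr 1
  ring

theorem kFun_smul (j : X →L[ℝ] Y) (s c : ℝ) (y : Y) : kFun j s (c • y) = |c| * kFun j s y := by
  refine le_antisymm (kFun_smul_le j s c y) ?_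
  rcases eq_or_ne c 0 with rfl | hc
  · simp [kFun_zero]
  · have h := kFun_smul_le j s c⁻¹ (c • y)
    rw [inv_smul_smul₀ hc, abs_inv] at h
    have hc' : 0 < |c| := abs_pos.mpr hc
    calc |c| * kFun j s y ≤ |c| * (|c|⁻¹ * kFun j s (c • y)) := by gcongr
      _ = kFun j s (c • y) := by field_simp

theorem kFun_monotoneOn (j : X →L[ℝ] Y) (y : Y) : MonotoneOn (fun s => kFun j s y) (Ioi 0) := by
  intro s hs t _ hst
  have hs' : (0 : ℝ) < s := hs
  refine ciInf_mono (kFun_bddBelow j s y) fun x => ?_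
  gcongr

theorem kFun_ge (j : X →L[ℝ] Y) {s : ℝ} (hs : 1 ≤ s) (y : Y) :
    ‖y‖ ≤ (1 + ‖j‖) * kFun j s y := by
  unfold kFun
  rw [Real.mul_iInf_of_nonneg (by positivity)]
  refine le_ciInf fun x => ?_
  have h1 : ‖y‖ ≤ ‖y - j x‖ + ‖j‖ * ‖x‖ := by
    calc ‖y‖ = ‖(y - j x) + j x‖ := by simp
      _ ≤ ‖y - j x‖ + ‖j x‖ := norm_add_le _ _
      _ ≤ _ := by gcongr; exact j.le_opNorm x
  have h2 : ‖y - j x‖ ≤ √(‖y - j x‖ ^ 2 + s ^ 2 * ‖x‖ ^ 2) :=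
    Real.le_sqrt_of_sq_le (by nlinarith [mul_nonneg (sq_nonneg s) (sq_nonneg ‖x‖)])
  have h3 : ‖x‖ ≤ √(‖y - j x‖ ^ 2 + s ^ 2 * ‖x‖ ^ 2) := by
    apply Real.le_sqrt_of_sq_le
    have : 1 * ‖x‖ ^ 2 ≤ s ^ 2 * ‖x‖ ^ 2 := by gcongr; nlinarith
    nlinarith [sq_nonneg ‖y - j x‖]
  nlinarith [mul_le_mul_of_nonneg_left h3 (norm_nonneg j)]

theorem aestronglyMeasurable_kFun (j : X →L[ℝ] Y) (y : Y) :
    AEStronglyMeasurable (fun s => kFun j s y / s) (volume.restrict (Ioi 0)) :=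
  ((aemeasurable_restrict_of_monotoneOn measurableSet_Ioi (kFun_monotoneOn j y)).div
    aemeasurable_id).aestronglyMeasurable

/-- Vectors `y ∈ Y` with `∫_0^∞ (s^{-1/2} K(s, y))² ds / s < ∞`. -/
noncomputable def halfSubmodule (j : X →L[ℝ] Y) : Submodule ℝ Y where
  carrier := {y | MemLp (fun s => kFun j s y / s) 2 (volume.restrict (Ioi 0))}
  zero_mem' := by simp [kFun_zero]
  add_mem' := by
    intro y z hy hz
    refine (MemLp.add hy hz).mono (aestronglyMeasurable_kFun j _) ?_
    filter_upwards [ae_restrict_mem measurableSet_Ioi] with s hs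
    have hs' : (0 : ℝ) < s := hs
    have h1 := kFun_nonneg j s y
    have h2 := kFun_nonneg j s z
    have h3 := kFun_nonneg j s (y + z)
    rw [Pi.add_apply, Real.norm_of_nonneg (by positivity), Real.norm_of_nonneg (by positivity),
      ← add_div]
    gcongr
    exact kFun_add_le j s y z
  smul_mem' := by
    intro c y hy
    have : (fun s => kFun j s (c • y) / s) = fun s => |c| * (kFun j s y / s) := by
      ext s; rw [kFun_smul, mul_div_assoc]
    rw [Set.mem_ofPred_eq, this]
    exact hy.const_mul _

/-- The interpolation space `[X, Y]_{1/2}` (the `K`-method with parameters `1/2, 2`), as a set of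
elements of `Y`.  It carries the norm `((2/π) ∫_0^∞ (s^{-1/2} K(s, y))² ds / s)^{1/2}`. -/
def HalfSpace (j : X →L[ℝ] Y) : Type _ := halfSubmodule j

noncomputable instance (j : X →L[ℝ] Y) : AddCommGroup (HalfSpace j) :=
  inferInstanceAs (AddCommGroup (halfSubmodule j))

noncomputable instance (j : X →L[ℝ] Y) : Module ℝ (HalfSpace j) :=
  inferInstanceAs (Module ℝ (halfSubmodule j))

/-- The inclusion `[X, Y]_{1/2} ⊆ Y`, as a linear map. -/
noncomputable def HalfSpace.toY (j : X →L[ℝ] Y) : HalfSpace j →ₗ[ℝ] Y := (halfSubmodule j).subtype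

noncomputable instance (j : X →L[ℝ] Y) : Norm (HalfSpace j) :=
  ⟨fun y => √(2 / Real.pi * ∫ s in Ioi (0 : ℝ), (kFun j s (HalfSpace.toY j y) / s) ^ 2)⟩

theorem HalfSpace.norm_def (j : X →L[ℝ] Y) (y : HalfSpace j) :
    ‖y‖ = √(2 / Real.pi * ∫ s in Ioi (0 : ℝ), (kFun j s (HalfSpace.toY j y) / s) ^ 2) := rfl

theorem HalfSpace.memLp (j : X →L[ℝ] Y) (y : HalfSpace j) :
    MemLp (fun s => kFun j s (HalfSpace.toY j y) / s) 2 (volume.restrict (Ioi 0)) := y.2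

theorem HalfSpace.norm_eq_eLpNorm (j : X →L[ℝ] Y) (y : HalfSpace j) :
    ‖y‖ = √(2 / Real.pi) *
      (eLpNorm (fun s => kFun j s (HalfSpace.toY j y) / s) 2 (volume.restrict (Ioi 0))).toReal := by
  rw [HalfSpace.norm_def, Real.sqrt_mul (by positivity),
    (HalfSpace.memLp j y).eLpNorm_eq_integral_rpow_norm (by norm_num) (by norm_num),
    ENNReal.toReal_ofReal (by positivity), Real.sqrt_eq_rpow (∫ s in Ioi (0 : ℝ), _)]
  simp [div_pow]

theorem HalfSpace.norm_toY_le (j : X →L[ℝ] Y) (y : HalfSpace j) :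
    ‖HalfSpace.toY j y‖ ≤ 2 * (1 + ‖j‖) * √(Real.pi / 2) * ‖y‖ := by
  set z := HalfSpace.toY j y with hz
  have hm := HalfSpace.memLp j y
  rw [← hz] at hm
  have hint : Integrable (fun s => (kFun j s z / s) ^ 2) (volume.restrict (Ioi 0)) :=
    hm.integrable_sq
  have hsub : Icc (1 : ℝ) 2 ⊆ Ioi 0 := fun s hs => lt_of_lt_of_le one_pos hs.1
  have h1 : ∫ s in Icc (1 : ℝ) 2, (‖z‖ / (2 * (1 + ‖j‖))) ^ 2
      ≤ ∫ s in Icc (1 : ℝ) 2, (kFun j s z / s) ^ 2 := by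
    refine setIntegral_mono_on (by simp) (IntegrableOn.mono_set hint hsub)
      measurableSet_Icc fun s hs => ?_
    have hs0 : 0 < s := hsub hs
    have h2 := kFun_ge j hs.1 z
    have hj : 0 < 1 + ‖j‖ := by positivity
    refine pow_le_pow_left₀ (by positivity) ?_ 2
    rw [div_le_div_iff₀ (by positivity) hs0]
    calc ‖z‖ * s ≤ ((1 + ‖j‖) * kFun j s z) * 2 :=
          mul_le_mul h2 hs.2 hs0.le (mul_nonneg hj.le (kFun_nonneg j s z))
      _ = _ := by ring
  have h2 : ∫ s in Icc (1 : ℝ) 2, (kFun j s z / s) ^ 2 ≤ ∫ s in Ioi (0 : ℝ), (kFun j s z / s) ^ 2 :=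
    setIntegral_mono_set hint (ae_of_all _ fun s => sq_nonneg _) hsub.eventuallyLE
  have h3 : ∫ s in Icc (1 : ℝ) 2, (‖z‖ / (2 * (1 + ‖j‖))) ^ 2 = (‖z‖ / (2 * (1 + ‖j‖))) ^ 2 := by
    simp; norm_num
  rw [h3] at h1
  have h4 : ‖z‖ / (2 * (1 + ‖j‖)) ≤ √(∫ s in Ioi (0 : ℝ), (kFun j s z / s) ^ 2) :=
    Real.le_sqrt_of_sq_le (h1.trans h2)
  have h5 : √(Real.pi / 2) * ‖y‖ = √(∫ s in Ioi (0 : ℝ), (kFun j s z / s) ^ 2) := by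
    rw [HalfSpace.norm_def, ← Real.sqrt_mul (by positivity), ← mul_assoc]
    rw [div_mul_div_cancel₀' (by norm_num) , div_self two_ne_zero, one_mul]
  rw [div_le_iff₀ (by positivity)] at h4
  rw [mul_assoc, h5]
  linarith

theorem HalfSpace.core (j : X →L[ℝ] Y) : NormedSpace.Core ℝ (HalfSpace j) where
  norm_nonneg _ := Real.sqrt_nonneg _
  norm_smul c y := by
    rw [HalfSpace.norm_def, HalfSpace.norm_def, map_smul]
    simp_rw [kFun_smul, mul_div_assoc, mul_pow, sq_abs]
    rw [integral_const_mul, mul_left_comm, Real.sqrt_mul (sq_nonneg c), Real.sqrt_sq_eq_abs,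
      Real.norm_eq_abs]
  norm_triangle y z := by
    simp only [HalfSpace.norm_eq_eLpNorm, ← mul_add]
    have hy := HalfSpace.memLp j y
    have hz := HalfSpace.memLp j z
    gcongr
    rw [← ENNReal.toReal_add hy.eLpNorm_ne_top hz.eLpNorm_ne_top]
    refine ENNReal.toReal_mono (ENNReal.add_ne_top.mpr ⟨hy.eLpNorm_ne_top, hz.eLpNorm_ne_top⟩) ?_
    refine le_trans ?_ (eLpNorm_add_le hy.1 hz.1 (by norm_num))
    refine eLpNorm_mono_ae ?_
    filter_upwards [ae_restrict_mem measurableSet_Ioi] with s hs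
    have hs' : (0 : ℝ) < s := hs
    rw [map_add]
    have h1 := kFun_nonneg j s (HalfSpace.toY j y)
    have h2 := kFun_nonneg j s (HalfSpace.toY j z)
    have h3 := kFun_nonneg j s (HalfSpace.toY j y + HalfSpace.toY j z)
    rw [Pi.add_apply, Real.norm_of_nonneg (by positivity), Real.norm_of_nonneg (by positivity),
      ← add_div]
    gcongr
    exact kFun_add_le j s _ _
  norm_eq_zero_iff y := by
    constructor
    · intro h
      have h1 := HalfSpace.norm_toY_le j y
      rw [h, mul_zero, norm_le_zero_iff] at h1
      exact (halfSubmodule j).injective_subtype (h1.trans (map_zero _).symm)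
    · rintro rfl
      simp [HalfSpace.norm_def, kFun_zero]

noncomputable instance (j : X →L[ℝ] Y) : NormedAddCommGroup (HalfSpace j) :=
  NormedAddCommGroup.ofCore (HalfSpace.core j)

noncomputable instance (j : X →L[ℝ] Y) : NormedSpace ℝ (HalfSpace j) :=
  NormedSpace.ofCore (HalfSpace.core j)

/-- The continuous inclusion `[X, Y]_{1/2} ↪ Y`. -/
noncomputable def HalfSpace.incl (j : X →L[ℝ] Y) : HalfSpace j →L[ℝ] Y :=
  (HalfSpace.toY j).mkContinuous _ (HalfSpace.norm_toY_le j)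

end

end HalfInterp

namespace WaveBEM

/-- `L²(0,T)` (real valued). -/
abbrev L2I (T : ℝ) : Type := Lp ℝ 2 (volume.restrict (Ioo (0 : ℝ) T))

/-- `g` is the weak derivative of `u` on the interval `(0,T)`. -/
def IsWeakDeriv (T : ℝ) (u g : ℝ → ℝ) : Prop :=
  ∀ φ : ℝ → ℝ, ContDiff ℝ ∞ φ → HasCompactSupport φ → tsupport φ ⊆ Ioo 0 T →
    ∫ t in Ioo 0 T, u t * deriv φ t = -∫ t in Ioo 0 T, g t * φ t

/-- The continuous representative of `u` on `[0,T]` exists and has the value `0` at `a`. -/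
def VanishesAt (T a : ℝ) (u : ℝ → ℝ) : Prop :=
  ∃ w : ℝ → ℝ, ContinuousOn w (Icc 0 T) ∧ u =ᵐ[volume.restrict (Ioo (0 : ℝ) T)] w ∧ w a = 0

/-- The two endpoints of the time interval. -/
inductive Endpoint
  | initial
  | final

/-- The initial endpoint is `0`, the final endpoint is `T`. -/
def Endpoint.time (T : ℝ) : Endpoint → ℝ
  | .initial => 0
  | .final => T

theorem Endpoint.time_mem {T : ℝ} (hT : 0 ≤ T) (e : Endpoint) : e.time T ∈ Icc 0 T := by
  cases e <;> simp [Endpoint.time, hT]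

theorem L2I.integrable {T : ℝ} (u : L2I T) : Integrable u (volume.restrict (Ioo (0 : ℝ) T)) :=
  (Lp.memLp u).integrable (by norm_num)

theorem integrable_mul_test {T : ℝ} {u φ : ℝ → ℝ}
    (hu : Integrable u (volume.restrict (Ioo (0 : ℝ) T)))
    (hφ : Continuous φ) (hc : HasCompactSupport φ) :
    Integrable (fun t => u t * φ t) (volume.restrict (Ioo (0 : ℝ) T)) := by
  obtain ⟨C, hC⟩ := hφ.bounded_above_of_compact_support hc
  exact hu.mul_bdd (c := C) hφ.aestronglyMeasurable (ae_of_all _ hC)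

theorem IsWeakDeriv.congr {T : ℝ} {u u' g g' : ℝ → ℝ} (h : IsWeakDeriv T u g)
    (hu : u =ᵐ[volume.restrict (Ioo (0 : ℝ) T)] u')
    (hg : g =ᵐ[volume.restrict (Ioo (0 : ℝ) T)] g') : IsWeakDeriv T u' g' := by
  intro φ h1 h2 h3
  have := h φ h1 h2 h3
  have e1 : ∫ t in Ioo 0 T, u t * deriv φ t = ∫ t in Ioo 0 T, u' t * deriv φ t :=
    integral_congr_ae (hu.mono fun t ht => by simp only [ht])
  have e2 : ∫ t in Ioo 0 T, g t * φ t = ∫ t in Ioo 0 T, g' t * φ t :=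
    integral_congr_ae (hg.mono fun t ht => by simp only [ht])
  rwa [e1, e2] at this

theorem IsWeakDeriv.add {T : ℝ} {u g v k : ℝ → ℝ} (h : IsWeakDeriv T u g) (h' : IsWeakDeriv T v k)
    (hu : Integrable u (volume.restrict (Ioo (0 : ℝ) T)))
    (hg : Integrable g (volume.restrict (Ioo (0 : ℝ) T)))
    (hv : Integrable v (volume.restrict (Ioo (0 : ℝ) T)))
    (hk : Integrable k (volume.restrict (Ioo (0 : ℝ) T))) :
    IsWeakDeriv T (u + v) (g + k) := by
  intro φ h1 h2 h3
  have hd : Continuous (deriv φ) := h1.continuous_deriv (by simp)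
  simp only [Pi.add_apply, add_mul]
  rw [integral_add (integrable_mul_test hu hd h2.deriv) (integrable_mul_test hv hd h2.deriv),
    integral_add (integrable_mul_test hg h1.continuous h2) (integrable_mul_test hk h1.continuous h2),
    h φ h1 h2 h3, h' φ h1 h2 h3]
  ring

theorem IsWeakDeriv.smul {T : ℝ} {u g : ℝ → ℝ} (h : IsWeakDeriv T u g) (c : ℝ) :
    IsWeakDeriv T (c • u) (c • g) := by
  intro φ h1 h2 h3
  simp only [Pi.smul_apply, smul_eq_mul, mul_assoc]
  rw [integral_const_mul, integral_const_mul, h φ h1 h2 h3]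
  ring

theorem ae_eq_zero_of_test {T : ℝ} {f : ℝ → ℝ}
    (hf : Integrable f (volume.restrict (Ioo (0 : ℝ) T)))
    (h : ∀ φ : ℝ → ℝ, ContDiff ℝ ∞ φ → HasCompactSupport φ → tsupport φ ⊆ Ioo 0 T →
      ∫ t in Ioo 0 T, f t * φ t = 0) : f =ᵐ[volume.restrict (Ioo (0 : ℝ) T)] 0 := by
  refine (ae_restrict_iff' measurableSet_Ioo).mpr ?_
  refine isOpen_Ioo.ae_eq_zero_of_integral_contDiff_smul_eq_zero
    (IntegrableOn.locallyIntegrableOn hf) fun φ h1 h2 h3 => ?_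
  rw [← h φ h1 h2 h3, ← setIntegral_eq_integral_of_forall_compl_eq_zero (s := Ioo 0 T)]
  · simp [mul_comm]
  · intro x hx
    rw [image_eq_zero_of_notMem_tsupport (fun hx' => hx (h3 hx')), zero_smul]

theorem IsWeakDeriv.unique {T : ℝ} {u g k : ℝ → ℝ} (h : IsWeakDeriv T u g) (h' : IsWeakDeriv T u k)
    (hg : Integrable g (volume.restrict (Ioo (0 : ℝ) T)))
    (hk : Integrable k (volume.restrict (Ioo (0 : ℝ) T))) :
    g =ᵐ[volume.restrict (Ioo (0 : ℝ) T)] k := by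
  have := ae_eq_zero_of_test (hg.sub hk) fun φ h1 h2 h3 => by
    simp only [Pi.sub_apply, sub_mul]
    rw [integral_sub (integrable_mul_test hg h1.continuous h2)
      (integrable_mul_test hk h1.continuous h2), sub_eq_zero, ← neg_inj, ← h φ h1 h2 h3,
      ← h' φ h1 h2 h3]
  exact this.mono fun t ht => sub_eq_zero.mp ht

/-- A function with vanishing weak derivative is constant. -/
theorem ae_eq_const_of_isWeakDeriv_zero {T : ℝ} (hT : 0 < T) {f : ℝ → ℝ}
    (hf : Integrable f (volume.restrict (Ioo (0 : ℝ) T))) (h : IsWeakDeriv T f 0) :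
    ∃ c : ℝ, f =ᵐ[volume.restrict (Ioo (0 : ℝ) T)] fun _ => c := by
  let B : ContDiffBump (T / 2) := ⟨T / 8, T / 4, by linarith, by linarith⟩
  set ψ : ℝ → ℝ := B.normed volume with hψ
  have hψ1 : ContDiff ℝ ∞ ψ := B.contDiff_normed
  have hψ2 : HasCompactSupport ψ := B.hasCompactSupport_normed
  have hψ3 : tsupport ψ ⊆ Ioo 0 T := by
    rw [hψ, B.tsupport_normed_eq, Real.closedBall_eq_Icc]
    intro x hx
    have h1 := hx.1
    have h2 := hx.2
    simp only [B] at h1 h2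
    constructor <;> linarith
  have hψ4 : ∫ t, ψ t = 1 := B.integral_normed
  set c := ∫ t in Ioo 0 T, f t * ψ t with hc
  refine ⟨c, ?_⟩
  have hfc : Integrable (fun t => f t - c) (volume.restrict (Ioo (0 : ℝ) T)) :=
    hf.sub (integrable_const c)
  have key := ae_eq_zero_of_test hfc fun θ h1 h2 h3 => ?_
  · exact key.mono fun t ht => sub_eq_zero.mp ht
  set m := ∫ t, θ t with hm
  set η : ℝ → ℝ := fun t => θ t - m * ψ t with hη
  have hη1 : ContDiff ℝ ∞ η := h1.sub (contDiff_const.mul hψ1)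
  -- the supports stay away from the endpoints
  obtain ⟨α, β, hα, hβ, hηs⟩ : ∃ α β : ℝ, 0 < α ∧ β < T ∧ ∀ t, t ∉ Icc α β → η t = 0 := by
    have hK : IsCompact (tsupport θ ∪ tsupport ψ) := h2.union hψ2
    have hKs : tsupport θ ∪ tsupport ψ ⊆ Ioo 0 T := union_subset h3 hψ3
    have hne : (tsupport θ ∪ tsupport ψ).Nonempty := by
      by_contra hemp
      rw [not_nonempty_iff_eq_empty, union_empty_iff] at hemp
      have : ψ = 0 := tsupport_eq_empty_iff.mp hemp.2
      rw [this] at hψ4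
      simp at hψ4
    refine ⟨sInf (tsupport θ ∪ tsupport ψ), sSup (tsupport θ ∪ tsupport ψ),
      (hKs (hK.sInf_mem hne)).1, (hKs (hK.sSup_mem hne)).2, fun t ht => ?_⟩
    have hnot : t ∉ tsupport θ ∪ tsupport ψ := fun hmem =>
      ht ⟨csInf_le hK.bddBelow hmem, le_csSup hK.bddAbove hmem⟩
    rw [mem_union, not_or] at hnot
    simp [hη, image_eq_zero_of_notMem_tsupport hnot.1, image_eq_zero_of_notMem_tsupport hnot.2]
  have hηc : HasCompactSupport η := HasCompactSupport.of_support_subset_isCompact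
    (K := Icc α β) isCompact_Icc fun t ht => by by_contra hh; exact ht (hηs t hh)
  have hηint : ∫ t, η t = 0 := by
    rw [hη, integral_sub (h1.continuous.integrable_of_hasCompactSupport h2)
      ((hψ1.continuous.integrable_of_hasCompactSupport hψ2).const_mul m), integral_const_mul, hψ4,
      mul_one, sub_self]
  set φ : ℝ → ℝ := fun t => ∫ s in (0 : ℝ)..t, η s with hφ
  have hder : ∀ t, HasDerivAt φ (η t) t := fun t =>
    intervalIntegral.integral_hasDerivAt_right (hη1.continuous.intervalIntegrable _ _)
      (hη1.continuous.stronglyMeasurableAtFilter _ _) hη1.continuous.continuousAt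
  have hderiv : deriv φ = η := funext fun t => (hder t).deriv
  have hφ1 : ContDiff ℝ ∞ φ :=
    contDiff_infty_iff_deriv.mpr ⟨fun t => (hder t).differentiableAt, by rwa [hderiv]⟩
  have hφs : ∀ t, t ∉ Icc α β → φ t = 0 := by
    intro t ht
    rw [mem_Icc, not_and_or, not_le, not_le] at ht
    rcases ht with ht | ht
    · refine intervalIntegral.integral_zero_ae (ae_of_all _ fun s hs => hηs s fun hs' => ?_)
      rcases le_total 0 t with h0 | h0
      · rw [uIoc_of_le h0] at hs
        linarith [hs.2, hs'.1]
      · rw [uIoc_of_ge h0] at hs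
        linarith [hs.2, hs'.1]
    · rw [← hηint, hφ]
      by_cases h0 : 0 ≤ t
      · simp only
        rw [intervalIntegral.integral_of_le h0]
        refine setIntegral_eq_integral_of_forall_compl_eq_zero fun s hs => hηs s fun hs' => hs ?_
        exact ⟨by linarith [hs'.1], by linarith [hs'.2]⟩
      · have : ∀ s, η s = 0 := fun s => hηs s fun hs' => by linarith [hs'.1, hs'.2]
        simp [this]
  have hsup : tsupport φ ⊆ Icc α β :=
    closure_minimal (fun t ht => by by_contra hh; exact ht (hφs t hh)) isClosed_Icc
  have hφ2 : HasCompactSupport φ := HasCompactSupport.of_support_subset_isCompact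
    (K := Icc α β) isCompact_Icc ((subset_tsupport φ).trans hsup)
  have hφ3 : tsupport φ ⊆ Ioo 0 T := fun t ht =>
    ⟨hα.trans_le (hsup ht).1, (hsup ht).2.trans_lt hβ⟩
  have hz := h φ hφ1 hφ2 hφ3
  rw [hderiv] at hz
  simp only [Pi.zero_apply, zero_mul, integral_zero, neg_zero] at hz
  have e1 : ∫ t in Ioo 0 T, f t * η t = (∫ t in Ioo 0 T, f t * θ t) - m * c := by
    rw [hc, ← integral_const_mul, ← integral_sub (integrable_mul_test hf h1.continuous h2)
      ((integrable_mul_test hf hψ1.continuous hψ2).const_mul m)]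
    congr 1
    ext t
    simp only [hη]
    ring
  have e2 : ∫ t in Ioo 0 T, θ t = m :=
    setIntegral_eq_integral_of_forall_compl_eq_zero fun t ht =>
      image_eq_zero_of_notMem_tsupport fun ht' => ht (h3 ht')
  simp only [sub_mul]
  rw [integral_sub (integrable_mul_test hf h1.continuous h2)
    ((h1.continuous.integrable_of_hasCompactSupport h2).restrict.const_mul c), integral_const_mul,
    e2]
  rw [e1] at hz
  linarith

theorem isWeakDeriv_integral {T a : ℝ} (hT : 0 ≤ T) (ha : a ∈ Icc 0 T) {g : ℝ → ℝ}
    (hg : Integrable g (volume.restrict (Ioo (0 : ℝ) T))) :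
    IsWeakDeriv T (fun t => ∫ s in a..t, g s) g := by
  intro φ h1 h2 h3
  have hgi : IntervalIntegrable g volume 0 T :=
    (intervalIntegrable_iff_integrableOn_Ioo_of_le hT).mpr hg
  have hG := hgi.absolutelyContinuousOnInterval_intervalIntegral (c := a) (by rwa [uIcc_of_le hT])
  have hφ : AbsolutelyContinuousOnInterval φ 0 T :=
    (h1.of_le (by simp)).contDiffOn.absolutelyContinuousOnInterval
  have hp := hG.integral_mul_deriv_eq_deriv_mul hφ
  have z0 : φ 0 = 0 := image_eq_zero_of_notMem_tsupport fun h => (lt_irrefl _ (h3 h).1)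
  have zT : φ T = 0 := image_eq_zero_of_notMem_tsupport fun h => (lt_irrefl _ (h3 h).2)
  rw [z0, zT, mul_zero, mul_zero, sub_zero, zero_sub] at hp
  rw [intervalIntegral.integral_of_le hT, integral_Ioc_eq_integral_Ioo] at hp
  rw [hp, neg_inj, ← integral_Ioc_eq_integral_Ioo, ← intervalIntegral.integral_of_le hT]
  refine intervalIntegral.integral_congr_ae ?_
  filter_upwards [hgi.ae_hasDerivAt_integral] with t ht hmem
  rw [(ht (uIoc_subset_uIcc hmem) a (by rwa [uIcc_of_le hT])).deriv]

/-- A weakly differentiable function that vanishes at `a` is the integral of its derivative. -/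
theorem IsWeakDeriv.ae_eq_integral {T a : ℝ} (hT : 0 < T) (ha : a ∈ Icc 0 T) {u g : ℝ → ℝ}
    (h : IsWeakDeriv T u g) (hv : VanishesAt T a u)
    (hu : Integrable u (volume.restrict (Ioo (0 : ℝ) T)))
    (hg : Integrable g (volume.restrict (Ioo (0 : ℝ) T))) :
    u =ᵐ[volume.restrict (Ioo (0 : ℝ) T)] fun t => ∫ s in a..t, g s := by
  obtain ⟨w, hw, huw, hwa⟩ := hv
  have hgi : IntervalIntegrable g volume 0 T :=
    (intervalIntegrable_iff_integrableOn_Ioo_of_le hT.le).mpr hg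
  have hG := hgi.absolutelyContinuousOnInterval_intervalIntegral (c := a)
    (by rwa [uIcc_of_le hT.le])
  have hGc : ContinuousOn (fun t => ∫ s in a..t, g s) (Icc 0 T) := by
    simpa [uIcc_of_le hT.le] using hG.continuousOn
  have hGi : Integrable (fun t => ∫ s in a..t, g s) (volume.restrict (Ioo (0 : ℝ) T)) :=
    (hGc.integrableOn_Icc).mono_set Ioo_subset_Icc_self
  have hneg := (isWeakDeriv_integral hT.le ha hg).smul (-1)
  have hsum := h.add hneg hu hg (hGi.smul (-1)) (hg.smul (-1))
  obtain ⟨c, hc⟩ := ae_eq_const_of_isWeakDeriv_zero hT (hu.add (hGi.smul (-1)))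
    (hsum.congr (Filter.EventuallyEq.refl _ _) (by simp))
  have hEq : EqOn w (fun t => c + ∫ s in a..t, g s) (Icc 0 T) := by
    refine Measure.eqOn_Icc_of_ae_eq volume hT.ne ?_ hw (continuousOn_const.add hGc)
    rw [restrict_Ioo_eq_restrict_Icc.symm]
    filter_upwards [huw, hc] with t h1 h2
    simp only [Pi.add_apply, Pi.smul_apply, smul_eq_mul] at h2
    rw [← h1]
    linarith
  have hc0 : c = 0 := by simpa [hwa] using (hEq ha).symm
  filter_upwards [huw, ae_restrict_mem measurableSet_Ioo] with t h1 h2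
  rw [h1, hEq (Ioo_subset_Icc_self h2), hc0]
  exact zero_add _

/-- `H¹_{0,}(0,T)` (for `e = initial`) resp. `H¹_{,0}(0,T)` (for `e = final`), as a subspace of
`L²(0,T)`: functions with weak derivative in `L²(0,T)` that vanish at the endpoint `e`. -/
def h1Submodule (T : ℝ) (e : Endpoint) : Submodule ℝ (L2I T) where
  carrier := {u | (∃ g : L2I T, IsWeakDeriv T u g) ∧ VanishesAt T (e.time T) u}
  zero_mem' := by
    have hz := Lp.coeFn_zero ℝ 2 (volume.restrict (Ioo (0 : ℝ) T))
    have h0 : IsWeakDeriv T 0 0 := fun φ _ _ _ => by simp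
    exact ⟨⟨0, h0.congr hz.symm hz.symm⟩, 0, continuousOn_const, hz, rfl⟩
  add_mem' := by
    rintro u v ⟨⟨g, hg⟩, w, hw, huw, hw0⟩ ⟨⟨k, hk⟩, z, hz, hvz, hz0⟩
    refine ⟨⟨g + k, ?_⟩, w + z, hw.add hz, (Lp.coeFn_add u v).trans (huw.add hvz), by simp [*]⟩
    exact (hg.add hk u.integrable g.integrable v.integrable k.integrable).congr
      (Lp.coeFn_add u v).symm (Lp.coeFn_add g k).symm
  smul_mem' := by
    rintro c u ⟨⟨g, hg⟩, w, hw, huw, hw0⟩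
    refine ⟨⟨c • g, ?_⟩, c • w, hw.const_smul c,
      (Lp.coeFn_smul c u).trans (huw.const_smul c), by simp [*]⟩
    exact (hg.smul c).congr (Lp.coeFn_smul c u).symm (Lp.coeFn_smul c g).symm

/-- The space `H¹_{0,}(0,T)` resp. `H¹_{,0}(0,T)`, with the norm `‖∂ₜ u‖_{L²(0,T)}`. -/
def H1 (T : ℝ) (e : Endpoint) : Type := h1Submodule T e

noncomputable instance (T : ℝ) (e : Endpoint) : AddCommGroup (H1 T e) :=
  inferInstanceAs (AddCommGroup (h1Submodule T e))

noncomputable instance (T : ℝ) (e : Endpoint) : Module ℝ (H1 T e) :=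
  inferInstanceAs (Module ℝ (h1Submodule T e))

/-- The inclusion into `L²(0,T)`, as a linear map. -/
noncomputable def H1.toL2 (T : ℝ) (e : Endpoint) : H1 T e →ₗ[ℝ] L2I T := (h1Submodule T e).subtype

theorem H1.exists_weakDeriv {T : ℝ} {e : Endpoint} (u : H1 T e) :
    ∃ g : L2I T, IsWeakDeriv T (H1.toL2 T e u) g := u.2.1

theorem H1.vanishesAt {T : ℝ} {e : Endpoint} (u : H1 T e) :
    VanishesAt T (e.time T) (H1.toL2 T e u) := u.2.2

theorem H1.weakDeriv_unique {T : ℝ} {u : ℝ → ℝ} {g k : L2I T} (hg : IsWeakDeriv T u g)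
    (hk : IsWeakDeriv T u k) : g = k :=
  Lp.ext (hg.unique hk g.integrable k.integrable)

/-- The weak time derivative `∂ₜ`. -/
noncomputable def H1.weakDeriv (T : ℝ) (e : Endpoint) : H1 T e →ₗ[ℝ] L2I T where
  toFun u := u.exists_weakDeriv.choose
  map_add' u v := by
    refine H1.weakDeriv_unique (u + v).exists_weakDeriv.choose_spec ?_
    rw [map_add]
    exact (u.exists_weakDeriv.choose_spec.add v.exists_weakDeriv.choose_spec (L2I.integrable _)
      (L2I.integrable _) (L2I.integrable _) (L2I.integrable _)).congr
      (Lp.coeFn_add _ _).symm (Lp.coeFn_add _ _).symm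
  map_smul' c u := by
    refine H1.weakDeriv_unique (c • u).exists_weakDeriv.choose_spec ?_
    rw [map_smul]
    exact (u.exists_weakDeriv.choose_spec.smul c).congr
      (Lp.coeFn_smul _ _).symm (Lp.coeFn_smul _ _).symm

theorem H1.isWeakDeriv {T : ℝ} {e : Endpoint} (u : H1 T e) :
    IsWeakDeriv T (H1.toL2 T e u) (H1.weakDeriv T e u) := u.exists_weakDeriv.choose_spec

theorem L2I.integral_norm_le {T : ℝ} (hT : 0 ≤ T) (g : L2I T) :
    ∫ t in Ioo 0 T, ‖g t‖ ≤ √T * ‖g‖ := by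
  have hg := Lp.memLp g
  have h1 := eLpNorm_le_eLpNorm_mul_rpow_measure_univ (p := 1) (q := 2)
    (μ := volume.restrict (Ioo (0 : ℝ) T)) (by norm_num) hg.1
  have h2 : ∫ t in Ioo 0 T, ‖g t‖ = (eLpNorm g 1 (volume.restrict (Ioo (0 : ℝ) T))).toReal := by
    rw [eLpNorm_one_eq_lintegral_enorm, integral_norm_eq_lintegral_enorm hg.1]
  rw [h2, Lp.norm_def]
  refine (ENNReal.toReal_mono ?_ h1).trans (le_of_eq ?_)
  · exact ENNReal.mul_ne_top hg.eLpNorm_ne_top (by norm_num)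
  · rw [ENNReal.toReal_mul, mul_comm]
    congr 1
    rw [Measure.restrict_apply_univ, Real.volume_Ioo, sub_zero, Real.sqrt_eq_rpow,
      ← ENNReal.toReal_rpow, ENNReal.toReal_ofReal hT]
    norm_num

/-- The Friedrichs inequality. -/
theorem H1.norm_toL2_le {T : ℝ} {e : Endpoint} (u : H1 T e) :
    ‖H1.toL2 T e u‖ ≤ T * ‖H1.weakDeriv T e u‖ := by
  rcases le_or_gt T 0 with hT | hT
  · have h0 : ∀ (μ : Measure ℝ) (f : ℝ → ℝ), μ = 0 → eLpNorm f 2 μ = 0 := by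
      rintro _ f rfl
      simp
    have hz : ∀ v : L2I T, ‖v‖ = 0 := fun v => by
      rw [Lp.norm_def, h0 _ _ (by rw [Ioo_eq_empty (not_lt.mpr hT), Measure.restrict_empty])]
      simp
    simp [hz]
  · set g := H1.weakDeriv T e u
    have hrep := u.isWeakDeriv.ae_eq_integral hT (e.time_mem hT.le) u.vanishesAt
      (L2I.integrable _) g.integrable
    have hb : ∀ᵐ t ∂(volume.restrict (Ioo (0 : ℝ) T)), ‖H1.toL2 T e u t‖ ≤ √T * ‖g‖ := by
      filter_upwards [hrep, ae_restrict_mem measurableSet_Ioo] with t h1 h2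
      rw [h1]
      refine (intervalIntegral.norm_integral_le_integral_norm_uIoc).trans ?_
      refine le_trans ?_ (L2I.integral_norm_le hT.le g)
      rw [← integral_Ioc_eq_integral_Ioo]
      refine setIntegral_mono_set ?_ (ae_of_all _ fun s => norm_nonneg _) ?_
      · exact (integrableOn_Ioc_iff_integrableOn_Ioo (μ := volume)).mpr g.integrable.norm
      · refine Filter.Eventually.of_forall fun s hs => ?_
        have ha := e.time_mem hT.le
        exact ⟨(le_min ha.1 h2.1.le).trans_lt hs.1, hs.2.trans (max_le ha.2 h2.2.le)⟩
    have := Lp.norm_le_of_ae_bound (by positivity) hb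
    refine this.trans (le_of_eq ?_)
    have hm : (measureUnivNNReal (volume.restrict (Ioo (0 : ℝ) T)) : ℝ) = T := by
      rw [measureUnivNNReal, ENNReal.coe_toNNReal_eq_toReal, Measure.restrict_apply_univ, Real.volume_Ioo,
        sub_zero, ENNReal.toReal_ofReal hT.le]
    have h2 : (ENNReal.toReal 2)⁻¹ = (1 / 2 : ℝ) := by norm_num
    rw [hm, h2, ← Real.sqrt_eq_rpow, ← mul_assoc, Real.mul_self_sqrt hT.le]

theorem H1.weakDeriv_injective (T : ℝ) (e : Endpoint) :
    Function.Injective (H1.weakDeriv T e) := by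
  refine (injective_iff_map_eq_zero _).mpr fun u hu => ?_
  have h := u.norm_toL2_le
  rw [hu, norm_zero, mul_zero, norm_le_zero_iff] at h
  exact (h1Submodule T e).injective_subtype (h.trans (map_zero _).symm)

noncomputable instance (T : ℝ) (e : Endpoint) : NormedAddCommGroup (H1 T e) :=
  NormedAddCommGroup.induced _ _ (H1.weakDeriv T e) (H1.weakDeriv_injective T e)

theorem H1.norm_def {T : ℝ} {e : Endpoint} (u : H1 T e) : ‖u‖ = ‖H1.weakDeriv T e u‖ := rfl

noncomputable instance (T : ℝ) (e : Endpoint) : NormedSpace ℝ (H1 T e) where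
  norm_smul_le c u := by rw [H1.norm_def, H1.norm_def, map_smul, norm_smul]

/-- The continuous embedding `H¹_{0,}(0,T) ↪ L²(0,T)` resp. `H¹_{,0}(0,T) ↪ L²(0,T)`. -/
noncomputable def H1.incl (T : ℝ) (e : Endpoint) : H1 T e →L[ℝ] L2I T :=
  (H1.toL2 T e).mkContinuous T fun u => u.norm_toL2_le

/-- `H^{1/2}_{0,}(0,T) = [H¹_{0,}(0,T), L²(0,T)]_{1/2}` for `e = initial`,
`H^{1/2}_{,0}(0,T) = [H¹_{,0}(0,T), L²(0,T)]_{1/2}` for `e = final`. -/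
abbrev HHalf (T : ℝ) (e : Endpoint) : Type := HalfInterp.HalfSpace (H1.incl T e)

/-- `L²(Σ) = L²(0,T) × L²(0,T)` with its Hilbert norm; the components of `w` are
`w.fst = w_0` (on `{0} × (0,T)`) and `w.snd = w_L` (on `{L} × (0,T)`). -/
abbrev L2Sigma (T : ℝ) : Type := WithLp 2 (L2I T × L2I T)

/-- `H^{1/2}_{0,}(Σ)` resp. `H^{1/2}_{,0}(Σ)`, with the norm `(‖z_0‖² + ‖z_L‖²)^{1/2}`. -/
abbrev HHalfSigma (T : ℝ) (e : Endpoint) : Type := WithLp 2 (HHalf T e × HHalf T e)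

/-- The embedding of `H^{1/2}_{0,}(Σ)` resp. `H^{1/2}_{,0}(Σ)` in `L²(Σ)`. -/
noncomputable def HHalfSigma.incl (T : ℝ) (e : Endpoint) : HHalfSigma T e →L[ℝ] L2Sigma T :=
  (WithLp.prodContinuousLinearEquiv 2 ℝ (L2I T) (L2I T)).symm.toContinuousLinearMap ∘L
    ((HalfInterp.HalfSpace.incl (H1.incl T e)).prodMap (HalfInterp.HalfSpace.incl (H1.incl T e))) ∘L
    (WithLp.prodContinuousLinearEquiv 2 ℝ (HHalf T e) (HHalf T e)).toContinuousLinearMap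

/-- `w ∈ L²(Σ)` as an element of the dual space: the functional `v ↦ ⟨w, v⟩_{L²(Σ)}`. -/
noncomputable def L2Sigma.toDual (T : ℝ) (e : Endpoint) (w : L2Sigma T) :
    StrongDual ℝ (HHalfSigma T e) :=
  innerSL ℝ w ∘L HHalfSigma.incl T e

/-- A function on `(0,T)`, extended by zero. -/
noncomputable def zeroExt (T : ℝ) (z : ℝ → ℝ) : ℝ → ℝ := (Ioo 0 T).indicator z

/-- `(V_0 w)(t) = ½ ∫_0^t w_0(s) ds + ½ ∫_0^{t-L} w_L(s) ds`. -/
noncomputable def singleLayer0 (L T : ℝ) (w : L2Sigma T) (t : ℝ) : ℝ :=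
  1 / 2 * (∫ s in (0 : ℝ)..t, zeroExt T w.fst s) +
    1 / 2 * ∫ s in (0 : ℝ)..(t - L), zeroExt T w.snd s

/-- `(V_L w)(t) = ½ ∫_0^{t-L} w_0(s) ds + ½ ∫_0^t w_L(s) ds`. -/
noncomputable def singleLayerL (L T : ℝ) (w : L2Sigma T) (t : ℝ) : ℝ :=
  1 / 2 * (∫ s in (0 : ℝ)..(t - L), zeroExt T w.fst s) +
    1 / 2 * ∫ s in (0 : ℝ)..t, zeroExt T w.snd s

/-- The function `z ∈ L²(Σ)` is `V w`, the single layer boundary integral operator applied to the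
density `w ∈ L²(Σ)`. -/
def IsSingleLayerOf (L T : ℝ) (w z : L2Sigma T) : Prop :=
  z.fst =ᵐ[volume.restrict (Ioo (0 : ℝ) T)] singleLayer0 L T w ∧
    z.snd =ᵐ[volume.restrict (Ioo (0 : ℝ) T)] singleLayerL L T w

end WaveBEM

/-!
The proof diagonalises everything. With `λ_k = (k + 1/2) π / T`, the normalised functions
`e_k ∼ sin (λ_k t)` and `f_k ∼ cos (λ_k t)` are Hilbert bases of `L²(0,T)`
(`WaveBEM.Endpoint.basis`); completeness follows from the Chebyshev recurrence in `cos (π t / T)`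
and the Weierstrass theorem (`WaveBEM.L2I.eq_zero_of_chebyshev`). The weak derivative is an isometry
of either `H¹` space onto `L²(0,T)`, and integration by parts shows that the `f_k`-coordinate of the
derivative of `u ∈ H¹_{0,}` is `λ_k` times the `e_k`-coordinate of `u`, and likewise, up to a sign,
for `H¹_{,0}` with `e` and `f` exchanged (`WaveBEM.isDiagonal_incl`).

For an embedding `X ↪ Y` that is diagonal with entries `ρ_k`, the infimum in the `K`-functional can
be computed in each coordinate, `K(s, y)² = ∑ s² y_k² / (s² + ρ_k²)`, and since
`∫_0^∞ ds / (s² + ρ²) = π / (2 |ρ|)`, the norm of `[X, Y]_{1/2}` is exactly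
`(∑ y_k² / |ρ_k|)^{1/2}` (`HalfInterp.IsDiagonal.norm_sq`). Hence both spaces `H^{1/2}` are isometric
to `ℓ²` by the coordinates `λ_k^{1/2} y_k`. As the antiderivative maps `f_k` to `e_k / λ_k`, it
becomes the inverse of the Riesz isomorphism of `ℓ²`, so it is an isometry of `[H^{1/2}_{,0}(Σ)]'`
onto `H^{1/2}_{0,}(Σ)` (`WaveBEM.HHalfSigma.primitive`).

The single layer operator is `½ (1 + N)` times the antiderivative, where
`N (z_0, z_L) = (z_L(· - L), z_0(· - L))`. The shift is a contraction of `L²(0,T)` and of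
`H¹_{0,}(0,T)`, so `N` is bounded on `H^{1/2}_{0,}(Σ)`; it is nilpotent because each application
delays by `L > 0` (`WaveBEM.HHalfSigma.isNilpotent_crosstalk`). So `1 + N` is invertible.
The extension is unique because `L²(Σ)` is dense in the dual
(`WaveBEM.L2Sigma.denseRange_toDual`), and the inf-sup condition holds for every isomorphism by the
Hahn–Banach theorem (`WaveBEM.exists_inf_sup`).
-/

/-! ### Interpolation spaces of diagonal embeddings -/

namespace HalfInterp

open scoped lp ENNReal InnerProductSpace

theorem hasSum_sq_lp {ι : Type*} (f : ℓ²(ι, ℝ)) : HasSum (fun k => f k ^ 2) (‖f‖ ^ 2) := by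
  have h := lp.hasSum_inner (𝕜 := ℝ) f f
  rw [real_inner_self_eq_norm_sq] at h
  simpa only [real_inner_self_eq_norm_sq, Real.norm_eq_abs, sq_abs] using h

theorem memℓp_two_of_summable_sq {ι : Type*} {f : ι → ℝ} (h : Summable fun k => f k ^ 2) :
    Memℓp f 2 := by
  refine memℓp_gen ?_
  simpa using h

theorem lintegral_inv_sq_add_sq {r : ℝ} (hr : r ≠ 0) :
    ∫⁻ s in Ioi (0 : ℝ), ENNReal.ofReal (1 / (s ^ 2 + r ^ 2)) =
      ENNReal.ofReal (Real.pi / (2 * |r|)) := by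
  have hr' : 0 < |r|⁻¹ := inv_pos.mpr (abs_pos.mpr hr)
  have e : ∀ s : ℝ, 1 / (s ^ 2 + r ^ 2) = (r ^ 2)⁻¹ * (1 + (|r|⁻¹ * s) ^ 2)⁻¹ := fun s => by
    rw [mul_pow, inv_pow, sq_abs]
    field_simp
    ring
  have hi : IntegrableOn (fun s : ℝ => 1 / (s ^ 2 + r ^ 2)) (Ioi 0) := by
    simp_rw [e]
    exact ((integrable_inv_one_add_sq.comp_mul_left' hr'.ne').const_mul _).integrableOn
  rw [← ofReal_integral_eq_lintegral_ofReal hi (ae_of_all _ fun s => by positivity)]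
  congr 1
  simp_rw [e]
  rw [integral_const_mul, integral_comp_mul_left_Ioi (fun s : ℝ => (1 + s ^ 2)⁻¹) 0 hr', mul_zero,
    integral_Ioi_inv_one_add_sq, Real.arctan_zero, sub_zero, inv_inv, smul_eq_mul, ← sq_abs r]
  field_simp

section

variable {ι X Y : Type*} [NormedAddCommGroup X] [NormedSpace ℝ X]
  [NormedAddCommGroup Y] [InnerProductSpace ℝ Y]

/-- In the coordinates given by the Hilbert basis `b` of `Y` and the isometry `a : X ≃ ℓ²`, the
embedding `j` is multiplication by the sequence `ρ` of nonzero reals. The signs of `ρ` are left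
free, so that `a` need not be adapted to them. -/
structure IsDiagonal (j : X →L[ℝ] Y) (b : HilbertBasis ι ℝ Y) (a : X ≃ₗᵢ[ℝ] ℓ²(ι, ℝ))
    (ρ : ι → ℝ) : Prop where
  ne_zero : ∀ k, ρ k ≠ 0
  repr_apply : ∀ x k, b.repr (j x) k = ρ k * a x k

variable {j : X →L[ℝ] Y} {b : HilbertBasis ι ℝ Y} {a : X ≃ₗᵢ[ℝ] ℓ²(ι, ℝ)} {ρ : ι → ℝ}

theorem IsDiagonal.abs_le (h : IsDiagonal j b a ρ) (k : ι) : |ρ k| ≤ ‖j‖ := by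
  classical
  have h1 := h.repr_apply (a.symm (lp.single 2 k 1)) k
  simp only [LinearIsometryEquiv.apply_symm_apply, lp.single_apply_self, mul_one] at h1
  rw [← h1, ← Real.norm_eq_abs]
  refine (lp.norm_apply_le_norm two_ne_zero _ k).trans ?_
  rw [LinearIsometryEquiv.norm_map]
  refine (j.le_opNorm _).trans (le_of_eq ?_)
  rw [LinearIsometryEquiv.norm_map, lp.norm_single (by norm_num)]
  simp

/-- The minimum over `c` of `(y - r c)² + s² c²` is attained at `c = r y / (s² + r²)`. -/
theorem le_sq_sub_add_sq {s : ℝ} (hs : 0 < s) (r y c : ℝ) :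
    s ^ 2 / (s ^ 2 + r ^ 2) * y ^ 2 ≤ (y - r * c) ^ 2 + s ^ 2 * c ^ 2 := by
  rw [div_mul_eq_mul_div, div_le_iff₀ (by positivity)]
  nlinarith [sq_nonneg ((s ^ 2 + r ^ 2) * c - r * y)]

theorem IsDiagonal.hasSum_objective (h : IsDiagonal j b a ρ) (s : ℝ) (y : Y) (x : X) :
    HasSum (fun k => (b.repr y k - ρ k * a x k) ^ 2 + s ^ 2 * a x k ^ 2)
      (‖y - j x‖ ^ 2 + s ^ 2 * ‖x‖ ^ 2) := by
  have h1 := hasSum_sq_lp (b.repr (y - j x))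
  have h2 := (hasSum_sq_lp (a x)).mul_left (s ^ 2)
  rw [LinearIsometryEquiv.norm_map] at h1 h2
  convert h1.add h2 using 3 with k
  rw [map_sub, lp.coeFn_sub, Pi.sub_apply, h.repr_apply]

/-- The `K`-functional of a diagonal embedding, by minimising each coordinate separately. -/
theorem IsDiagonal.hasSum_kFun_sq (h : IsDiagonal j b a ρ) {s : ℝ} (hs : 0 < s) (y : Y) :
    HasSum (fun k => s ^ 2 / (s ^ 2 + ρ k ^ 2) * b.repr y k ^ 2) (kFun j s y ^ 2) := by
  have hy := (hasSum_sq_lp (b.repr y)).summable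
  have hS : Summable fun k => s ^ 2 / (s ^ 2 + ρ k ^ 2) * b.repr y k ^ 2 := by
    refine hy.of_nonneg_of_le (fun k => by positivity) fun k => ?_
    refine mul_le_of_le_one_left (sq_nonneg _) ?_
    rw [div_le_one (by positivity)]
    nlinarith [sq_nonneg (ρ k)]
  have hm : Memℓp (fun k => ρ k * b.repr y k / (s ^ 2 + ρ k ^ 2)) 2 := by
    refine memℓp_two_of_summable_sq ?_
    refine (hy.mul_left (s ^ 2)⁻¹).of_nonneg_of_le (fun k => sq_nonneg _) fun k => ?_
    rw [div_pow, mul_pow, inv_mul_eq_div, div_le_div_iff₀ (by positivity) (by positivity)]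
    nlinarith [mul_nonneg (sq_nonneg (b.repr y k)) (add_nonneg (sq_nonneg (s ^ 2))
      (add_nonneg (mul_nonneg (sq_nonneg s) (sq_nonneg (ρ k))) (sq_nonneg (ρ k ^ 2))))]
  obtain ⟨x, hx⟩ := a.surjective ⟨_, hm⟩
  have hle : kFun j s y ≤ √(∑' k, s ^ 2 / (s ^ 2 + ρ k ^ 2) * b.repr y k ^ 2) := by
    refine (kFun_le j s y x).trans (le_of_eq ?_)
    rw [← (h.hasSum_objective s y x).tsum_eq]
    congr 2
    ext k
    rw [hx]
    have : s ^ 2 + ρ k ^ 2 ≠ 0 := by positivity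
    change (_ - ρ k * (ρ k * b.repr y k / (s ^ 2 + ρ k ^ 2))) ^ 2 +
      s ^ 2 * (ρ k * b.repr y k / (s ^ 2 + ρ k ^ 2)) ^ 2 = _
    field_simp
    ring
  have hge : √(∑' k, s ^ 2 / (s ^ 2 + ρ k ^ 2) * b.repr y k ^ 2) ≤ kFun j s y := by
    refine le_ciInf fun x => Real.sqrt_le_sqrt ?_
    have hx := h.hasSum_objective s y x
    rw [← hx.tsum_eq]
    exact hS.tsum_le_tsum (fun k => le_sq_sub_add_sq hs _ _ _) hx.summable
  rw [hle.antisymm hge, Real.sq_sqrt (tsum_nonneg fun k => by positivity)]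
  exact hS.hasSum

theorem IsDiagonal.lintegral_kFun [Countable ι] (h : IsDiagonal j b a ρ) (y : Y) :
    ∫⁻ s in Ioi (0 : ℝ), ENNReal.ofReal ((kFun j s y / s) ^ 2) =
      ENNReal.ofReal (Real.pi / 2) * ∑' k, ENNReal.ofReal (b.repr y k ^ 2 / |ρ k|) := by
  have h1 : ∀ s ∈ Ioi (0 : ℝ), ENNReal.ofReal ((kFun j s y / s) ^ 2) =
      ∑' k, ENNReal.ofReal (b.repr y k ^ 2) * ENNReal.ofReal (1 / (s ^ 2 + ρ k ^ 2)) := by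
    intro s hs
    have hs' : (0 : ℝ) < s := hs
    have h2 := (h.hasSum_kFun_sq hs' y).div_const (s ^ 2)
    rw [div_pow, ← h2.tsum_eq, ENNReal.ofReal_tsum_of_nonneg (fun k => by positivity) h2.summable]
    congr 1
    ext k
    rw [← ENNReal.ofReal_mul (sq_nonneg _)]
    congr 1
    have : s ^ 2 + ρ k ^ 2 ≠ 0 := by positivity
    field_simp
  rw [setLIntegral_congr_fun measurableSet_Ioi h1, lintegral_tsum
    (fun k => (by fun_prop : Measurable _).aemeasurable), ← ENNReal.tsum_mul_left]
  congr 1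
  ext k
  rw [lintegral_const_mul _ (by fun_prop), lintegral_inv_sq_add_sq (h.ne_zero k),
    ← ENNReal.ofReal_mul (sq_nonneg _), ← ENNReal.ofReal_mul (by positivity)]
  congr 1
  have := abs_pos.mpr (h.ne_zero k)
  field_simp

theorem IsDiagonal.mem_halfSubmodule [Countable ι] (h : IsDiagonal j b a ρ) {y : Y} :
    y ∈ halfSubmodule j ↔ Summable fun k => b.repr y k ^ 2 / |ρ k| := by
  change MemLp _ _ _ ↔ _
  have hpos : ENNReal.ofReal (Real.pi / 2) ≠ 0 := by
    simpa using Real.pi_pos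
  rw [memLp_two_iff_integrable_sq (aestronglyMeasurable_kFun j y), Integrable,
    and_iff_right (by exact (aestronglyMeasurable_kFun j y).pow 2),
    hasFiniteIntegral_iff_ofReal (ae_of_all _ fun s => sq_nonneg _), h.lintegral_kFun,
    ENNReal.mul_lt_top_iff]
  constructor
  · rintro (⟨-, h1⟩ | h1 | h1)
    · refine (ENNReal.summable_toReal h1.ne).congr fun k => ?_
      rw [ENNReal.toReal_ofReal (by positivity)]
    · exact absurd h1 hpos
    · rw [ENNReal.tsum_eq_zero] at h1
      refine summable_zero.congr fun k => ?_
      exact (le_antisymm (ENNReal.ofReal_eq_zero.mp (h1 k)) (by positivity)).symm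
  · intro hs
    refine Or.inl ⟨ENNReal.ofReal_lt_top, ?_⟩
    rw [← ENNReal.ofReal_tsum_of_nonneg (fun k => by positivity) hs]
    exact ENNReal.ofReal_lt_top

/-- With the normalisation `2/π`, the norm of `[X, Y]_{1/2}` is the `ℓ²` norm with weights
`|ρ k|⁻¹`. -/
theorem IsDiagonal.norm_sq [Countable ι] (h : IsDiagonal j b a ρ) (y : HalfSpace j) :
    ‖y‖ ^ 2 = ∑' k, b.repr (HalfSpace.toY j y) k ^ 2 / |ρ k| := by
  have hs : Summable fun k => b.repr (HalfSpace.toY j y) k ^ 2 / |ρ k| :=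
    h.mem_halfSubmodule.mp y.2
  have hm := HalfSpace.memLp j y
  have hi : 0 ≤ ∫ s in Ioi (0 : ℝ), (kFun j s (HalfSpace.toY j y) / s) ^ 2 :=
    integral_nonneg fun s => sq_nonneg _
  rw [HalfSpace.norm_def, Real.sq_sqrt (by positivity),
    integral_eq_lintegral_of_nonneg_ae (ae_of_all _ fun s => sq_nonneg _) (hm.1.pow 2),
    h.lintegral_kFun, ← ENNReal.ofReal_tsum_of_nonneg (fun k => by positivity) hs,
    ENNReal.toReal_mul, ENNReal.toReal_ofReal (by positivity),
    ENNReal.toReal_ofReal (tsum_nonneg fun k => by positivity), ← mul_assoc,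
    div_mul_div_cancel₀ Real.pi_ne_zero, div_self two_ne_zero, one_mul]

theorem IsDiagonal.hasSum_norm_sq [Countable ι] (h : IsDiagonal j b a ρ) (y : HalfSpace j) :
    HasSum (fun k => b.repr (HalfSpace.toY j y) k ^ 2 / |ρ k|) (‖y‖ ^ 2) :=
  h.norm_sq y ▸ (h.mem_halfSubmodule.mp y.2).hasSum

theorem inv_sqrt_abs_mul_sq (r t : ℝ) : ((√|r|)⁻¹ * t) ^ 2 = t ^ 2 / |r| := by
  rw [mul_pow, inv_pow, Real.sq_sqrt (abs_nonneg r), inv_mul_eq_div]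

/-- The weighted coordinates `y ↦ (|ρ k|^{-1/2} ⟨b k, y⟩)_k`, as an isometry of `[X, Y]_{1/2}`
into `ℓ²`. -/
noncomputable def IsDiagonal.toLp [Countable ι] (h : IsDiagonal j b a ρ) :
    HalfSpace j →ₗᵢ[ℝ] ℓ²(ι, ℝ) where
  toFun y := ⟨fun k => (√|ρ k|)⁻¹ * b.repr (HalfSpace.toY j y) k, memℓp_two_of_summable_sq <| by
    simpa only [inv_sqrt_abs_mul_sq] using (h.hasSum_norm_sq y).summable⟩
  map_add' y z := by
    ext k
    simp only [map_add, lp.coeFn_add, Pi.add_apply, mul_add]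
  map_smul' c y := by
    ext k
    simp only [map_smul, lp.coeFn_smul, Pi.smul_apply, smul_eq_mul, RingHom.id_apply]
    ring
  norm_map' y := by
    rw [← sq_eq_sq₀ (norm_nonneg _) (norm_nonneg _)]
    refine (hasSum_sq_lp _).unique ?_
    simpa only [LinearMap.coe_mk, AddHom.coe_mk, inv_sqrt_abs_mul_sq] using h.hasSum_norm_sq y

theorem IsDiagonal.toLp_apply [Countable ι] (h : IsDiagonal j b a ρ) (y : HalfSpace j) (k : ι) :
    h.toLp y k = (√|ρ k|)⁻¹ * b.repr (HalfSpace.toY j y) k := rfl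

theorem IsDiagonal.toLp_surjective [Countable ι] (h : IsDiagonal j b a ρ) :
    Function.Surjective h.toLp := by
  intro c
  have hm : Memℓp (fun k => √|ρ k| * c k) 2 := by
    refine memℓp_two_of_summable_sq ?_
    refine ((hasSum_sq_lp c).summable.mul_left ‖j‖).of_nonneg_of_le (fun k => sq_nonneg _)
      fun k => ?_
    rw [mul_pow, Real.sq_sqrt (abs_nonneg _)]
    exact mul_le_mul_of_nonneg_right (h.abs_le k) (sq_nonneg _)
  have hr : ∀ k, b.repr (b.repr.symm ⟨_, hm⟩) k = √|ρ k| * c k := fun k => by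
    rw [LinearIsometryEquiv.apply_symm_apply]
  have hmem : b.repr.symm ⟨_, hm⟩ ∈ halfSubmodule j := by
    refine h.mem_halfSubmodule.mpr ((hasSum_sq_lp c).summable.congr fun k => ?_)
    have := abs_pos.mpr (h.ne_zero k)
    rw [hr, mul_pow, Real.sq_sqrt (abs_nonneg _)]
    field_simp
  refine ⟨⟨_, hmem⟩, ?_⟩
  ext k
  have := Real.sqrt_pos.mpr (abs_pos.mpr (h.ne_zero k))
  change (√|ρ k|)⁻¹ * b.repr (b.repr.symm ⟨_, hm⟩) k = c k
  rw [hr, inv_mul_cancel_left₀ this.ne']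

/-- `[X, Y]_{1/2}` is isometric to `ℓ²` by weighted coordinates. -/
noncomputable def IsDiagonal.equivLp [Countable ι] (h : IsDiagonal j b a ρ) :
    HalfSpace j ≃ₗᵢ[ℝ] ℓ²(ι, ℝ) :=
  LinearIsometryEquiv.ofSurjective h.toLp h.toLp_surjective

theorem IsDiagonal.repr_toY [Countable ι] (h : IsDiagonal j b a ρ) (y : HalfSpace j) (k : ι) :
    b.repr (HalfSpace.toY j y) k = √|ρ k| * h.equivLp y k := by
  have := Real.sqrt_pos.mpr (abs_pos.mpr (h.ne_zero k))
  change _ = √|ρ k| * h.toLp y k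
  rw [h.toLp_apply, mul_inv_cancel_left₀ this.ne']

end

end HalfInterp

/-! ### The weak derivative as an isometry, and integration by parts -/

namespace WaveBEM

open scoped lp InnerProductSpace

theorem memLp_of_continuousOn {T : ℝ} {w : ℝ → ℝ} (hw : ContinuousOn w (Icc 0 T)) :
    MemLp w 2 (volume.restrict (Ioo (0 : ℝ) T)) := by
  obtain ⟨C, hC⟩ := isCompact_Icc.exists_bound_of_continuousOn hw
  refine MemLp.of_bound ((hw.mono Ioo_subset_Icc_self).aestronglyMeasurable measurableSet_Ioo) C ?_
  filter_upwards [ae_restrict_mem measurableSet_Ioo] with t ht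
  exact hC t (Ioo_subset_Icc_self ht)

theorem L2I.integrable_mul {T : ℝ} (u : L2I T) {φ : ℝ → ℝ} (hφ : Continuous φ) :
    Integrable (fun t => u t * φ t) (volume.restrict (Ioo (0 : ℝ) T)) :=
  IntegrableOn.mul_continuousOn_of_subset u.integrable hφ.continuousOn measurableSet_Ioo
    isCompact_Icc Ioo_subset_Icc_self

theorem L2I.inner_toLp {T : ℝ} (u : L2I T) {φ : ℝ → ℝ}
    (hφ : MemLp φ 2 (volume.restrict (Ioo (0 : ℝ) T))) :
    ⟪hφ.toLp φ, u⟫_ℝ = ∫ t in Ioo 0 T, u t * φ t := by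
  rw [L2.inner_def]
  refine integral_congr_ae ?_
  filter_upwards [hφ.coeFn_toLp] with t ht
  rw [ht]
  rfl

theorem L2I.absolutelyContinuousOnInterval_integral {T a : ℝ} (hT : 0 < T) (ha : a ∈ Icc 0 T)
    (g : L2I T) : AbsolutelyContinuousOnInterval (fun t => ∫ s in a..t, g s) 0 T :=
  ((intervalIntegrable_iff_integrableOn_Ioo_of_le hT.le).mpr
    g.integrable).absolutelyContinuousOnInterval_intervalIntegral (c := a)
    (by rwa [uIcc_of_le hT.le])

theorem L2I.continuousOn_integral {T a : ℝ} (hT : 0 < T) (ha : a ∈ Icc 0 T) (g : L2I T) :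
    ContinuousOn (fun t => ∫ s in a..t, g s) (Icc 0 T) := by
  simpa [uIcc_of_le hT.le] using (g.absolutelyContinuousOnInterval_integral hT ha).continuousOn

theorem H1.weakDeriv_surjective {T : ℝ} (hT : 0 < T) (e : Endpoint) :
    Function.Surjective (H1.weakDeriv T e) := by
  intro g
  have hc := g.continuousOn_integral hT (e.time_mem hT.le)
  have hw := (memLp_of_continuousOn hc).coeFn_toLp
  have hd := (isWeakDeriv_integral hT.le (e.time_mem hT.le) g.integrable).congr hw.symm
    (Filter.EventuallyEq.refl _ _)
  let u : H1 T e := ⟨(memLp_of_continuousOn hc).toLp _, ⟨g, hd⟩, _, hc, hw,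
    intervalIntegral.integral_same⟩
  exact ⟨u, H1.weakDeriv_unique u.isWeakDeriv hd⟩

/-- The weak derivative, as an isometry of `H¹_{0,}(0,T)` resp. `H¹_{,0}(0,T)` onto `L²(0,T)`. -/
noncomputable def H1.derivEquiv {T : ℝ} (hT : 0 < T) (e : Endpoint) : H1 T e ≃ₗᵢ[ℝ] L2I T :=
  LinearIsometryEquiv.ofSurjective ⟨H1.weakDeriv T e, fun _ => rfl⟩ (H1.weakDeriv_surjective hT e)

theorem H1.derivEquiv_apply {T : ℝ} (hT : 0 < T) {e : Endpoint} (u : H1 T e) :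
    H1.derivEquiv hT e u = H1.weakDeriv T e u := rfl

theorem H1.incl_ae_eq {T : ℝ} (hT : 0 < T) {e : Endpoint} (u : H1 T e) :
    H1.incl T e u =ᵐ[volume.restrict (Ioo (0 : ℝ) T)]
      fun t => ∫ s in e.time T..t, H1.weakDeriv T e u s :=
  u.isWeakDeriv.ae_eq_integral hT (e.time_mem hT.le) u.vanishesAt (L2I.integrable _)
    (L2I.integrable _)

/-- The opposite endpoint. -/
def Endpoint.opp : Endpoint → Endpoint
  | .initial => .final
  | .final => .initial

/-- Integration by parts against functions that vanish at the opposite endpoint only. -/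
theorem H1.integral_mul_deriv {T : ℝ} (hT : 0 < T) {e : Endpoint} (u : H1 T e) {φ φ' : ℝ → ℝ}
    (hφ : ∀ t, HasDerivAt φ (φ' t) t) (hφ' : Continuous φ') (h0 : φ (e.opp.time T) = 0) :
    ∫ t in Ioo 0 T, H1.incl T e u t * φ' t = -∫ t in Ioo 0 T, H1.weakDeriv T e u t * φ t := by
  set g := H1.weakDeriv T e u
  have ha := e.time_mem hT.le
  have hd : deriv φ = φ' := funext fun t => (hφ t).deriv
  have hgi : IntervalIntegrable g volume 0 T :=
    (intervalIntegrable_iff_integrableOn_Ioo_of_le hT.le).mpr g.integrable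
  have hG := g.absolutelyContinuousOnInterval_integral hT ha
  have hφ1 : ContDiff ℝ 1 φ :=
    contDiff_one_iff_deriv.mpr ⟨fun t => (hφ t).differentiableAt, by rwa [hd]⟩
  have hp := hG.integral_mul_deriv_eq_deriv_mul hφ1.contDiffOn.absolutelyContinuousOnInterval
  have hb : (∫ s in e.time T..T, g s) * φ T - (∫ s in e.time T..0, g s) * φ 0 = 0 := by
    cases e <;> simp_all [Endpoint.opp, Endpoint.time]
  rw [hb, zero_sub, hd, intervalIntegral.integral_of_le hT.le, integral_Ioc_eq_integral_Ioo] at hp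
  rw [integral_congr_ae (g := fun t => (∫ s in e.time T..t, g s) * φ' t)
    ((H1.incl_ae_eq hT u).mono fun t ht => by simp only [ht, g]), hp, neg_inj,
    ← integral_Ioc_eq_integral_Ioo, ← intervalIntegral.integral_of_le hT.le]
  refine intervalIntegral.integral_congr_ae ?_
  filter_upwards [hgi.ae_hasDerivAt_integral] with t ht hmem
  rw [(ht (uIoc_subset_uIcc hmem) _ (by rwa [uIcc_of_le hT.le])).deriv]

/-! ### The trigonometric Hilbert bases -/

/-- The frequencies `(k + 1/2) π / T`. -/
noncomputable def freq (T : ℝ) (k : ℕ) : ℝ := (k + 1 / 2) * (Real.pi / T)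

theorem freq_pos {T : ℝ} (hT : 0 < T) (k : ℕ) : 0 < freq T k := by
  have := Real.pi_pos
  unfold freq
  positivity

/-- The sine for the initial endpoint, the cosine for the final one: `trig (freq T k * t)` vanishes
at the given endpoint and has vanishing derivative at the other. -/
noncomputable def Endpoint.trig : Endpoint → ℝ → ℝ
  | .initial => Real.sin
  | .final => Real.cos

theorem Endpoint.continuous_trig (e : Endpoint) : Continuous e.trig := by
  cases e
  exacts [Real.continuous_sin, Real.continuous_cos]

theorem Endpoint.trig_time {T : ℝ} (hT : 0 < T) (e : Endpoint) (k : ℕ) :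
    e.trig (freq T k * e.time T) = 0 := by
  cases e
  · simp [Endpoint.trig, Endpoint.time]
  · simp only [Endpoint.trig, Endpoint.time, freq]
    rw [Real.cos_eq_zero_iff]
    refine ⟨k, ?_⟩
    push_cast
    field_simp

/-- The singular values of the antiderivative, with the sign it has for the given endpoint. -/
noncomputable def Endpoint.sval (T : ℝ) (k : ℕ) : Endpoint → ℝ
  | .initial => (freq T k)⁻¹
  | .final => -(freq T k)⁻¹

theorem Endpoint.hasDerivAt_trig {T : ℝ} (hT : 0 < T) (e : Endpoint) (k : ℕ) (t : ℝ) :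
    HasDerivAt (fun t => -e.sval T k * e.opp.trig (freq T k * t)) (e.trig (freq T k * t)) t := by
  have hf := (freq_pos hT k).ne'
  have h1 : HasDerivAt (fun t => freq T k * t) (freq T k) t := by
    simpa using (hasDerivAt_id t).const_mul (freq T k)
  cases e
  · change HasDerivAt (fun t => -(freq T k)⁻¹ * Real.cos (freq T k * t)) (Real.sin (freq T k * t)) t
    exact (h1.cos.const_mul _).congr_deriv (by field_simp)
  · change HasDerivAt (fun t => - -(freq T k)⁻¹ * Real.sin (freq T k * t))
      (Real.cos (freq T k * t)) t
    exact (h1.sin.const_mul _).congr_deriv (by field_simp)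

theorem integral_cos_int_mul {T : ℝ} (hT : 0 < T) {n : ℤ} (hn : n ≠ 0) :
    ∫ t in Ioo 0 T, Real.cos (n * (Real.pi / T) * t) = 0 := by
  have hc : (n : ℝ) * (Real.pi / T) ≠ 0 :=
    mul_ne_zero (Int.cast_ne_zero.mpr hn) (div_ne_zero Real.pi_ne_zero hT.ne')
  rw [← integral_Ioc_eq_integral_Ioo, ← intervalIntegral.integral_of_le hT.le,
    intervalIntegral.integral_comp_mul_left (fun t => Real.cos t) hc, integral_cos, mul_zero,
    Real.sin_zero, mul_assoc, div_mul_cancel₀ _ hT.ne', Real.sin_int_mul_pi]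
  simp

theorem Endpoint.integral_trig_mul_trig {T : ℝ} (hT : 0 < T) (e : Endpoint) (m k : ℕ) :
    ∫ t in Ioo 0 T, e.trig (freq T m * t) * e.trig (freq T k * t) = if m = k then T / 2 else 0 := by
  have hci : ∀ c : ℝ, Integrable (fun t => Real.cos (c * t)) (volume.restrict (Ioo 0 T)) := fun c =>
    (by fun_prop : Continuous fun t => Real.cos (c * t)).integrableOn_Icc.mono_set
      Ioo_subset_Icc_self
  have hsum := integral_cos_int_mul hT (n := (m : ℤ) + k + 1) (by positivity)
  have hdiff : ∫ t in Ioo 0 T, Real.cos (((m - k : ℤ) : ℝ) * (Real.pi / T) * t) =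
      if m = k then T else 0 := by
    split_ifs with h
    · subst h
      simp [hT.le]
    · exact integral_cos_int_mul hT (by omega)
  obtain ⟨c, hc⟩ : ∃ c : ℝ, ∀ t, e.trig (freq T m * t) * e.trig (freq T k * t) =
      2⁻¹ * Real.cos (((m - k : ℤ) : ℝ) * (Real.pi / T) * t) +
        c * Real.cos (((m + k + 1 : ℤ) : ℝ) * (Real.pi / T) * t) := by
    have e1 : ∀ t, ((m - k : ℤ) : ℝ) * (Real.pi / T) * t = freq T m * t - freq T k * t := fun t => by
      unfold freq; push_cast; ring
    have e2 : ∀ t, ((m + k + 1 : ℤ) : ℝ) * (Real.pi / T) * t = freq T m * t + freq T k * t :=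
      fun t => by unfold freq; push_cast; ring
    simp only [e1, e2, Real.cos_sub, Real.cos_add]
    cases e
    · exact ⟨-2⁻¹, fun t => by simp only [Endpoint.trig]; ring⟩
    · exact ⟨2⁻¹, fun t => by simp only [Endpoint.trig]; ring⟩
  simp_rw [hc]
  rw [integral_add ((hci _).const_mul _) ((hci _).const_mul _), integral_const_mul,
    integral_const_mul, hsum, hdiff]
  split_ifs <;> ring

/-- Completeness of a system `φ k` on `(0,T)` that is obtained from a nonvanishing `φ 0` by the
Chebyshev recurrence in `cos (π t / T)`: a function orthogonal to the system is orthogonal to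
`φ 0` times every polynomial in `cos (π t / T)`, hence to `φ 0` times every continuous function. -/
theorem L2I.eq_zero_of_chebyshev {T : ℝ} (hT : 0 < T) {φ : ℕ → ℝ → ℝ} (hc : ∀ k, Continuous (φ k))
    (hne : ∀ t ∈ Ioo 0 T, φ 0 t ≠ 0) {r : ℝ}
    (h0 : ∀ t, 2 * Real.cos (Real.pi / T * t) * φ 0 t = φ 1 t + r * φ 0 t)
    (hrec : ∀ k t, 2 * Real.cos (Real.pi / T * t) * φ (k + 1) t = φ (k + 2) t + φ k t)
    {f : L2I T} (hf : ∀ k, ∫ t in Ioo 0 T, f t * φ k t = 0) : f = 0 := by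
  set x : ℝ → ℝ := fun t => Real.cos (Real.pi / T * t) with hx
  have hxc : Continuous x := by fun_prop
  have hpow : ∀ n k, ∫ t in Ioo 0 T, f t * (φ k t * x t ^ n) = 0 := by
    intro n
    induction n with
    | zero => simpa using hf
    | succ n ih =>
      have hi : ∀ k, Integrable (fun t => f t * (φ k t * x t ^ n))
          (volume.restrict (Ioo (0 : ℝ) T)) := fun k =>
        f.integrable_mul ((hc k).mul (hxc.pow n))
      rintro (_ | k)
      · have : ∀ t, f t * (φ 0 t * x t ^ (n + 1)) =
            2⁻¹ * (f t * (φ 1 t * x t ^ n)) + r / 2 * (f t * (φ 0 t * x t ^ n)) := fun t => by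
          rw [pow_succ]
          linear_combination (f t * x t ^ n / 2) * h0 t
        simp_rw [this]
        rw [integral_add ((hi 1).const_mul _) ((hi 0).const_mul _), integral_const_mul,
          integral_const_mul, ih, ih]
        simp
      · have : ∀ t, f t * (φ (k + 1) t * x t ^ (n + 1)) =
            2⁻¹ * (f t * (φ (k + 2) t * x t ^ n)) + 2⁻¹ * (f t * (φ k t * x t ^ n)) := fun t => by
          rw [pow_succ]
          linear_combination (f t * x t ^ n / 2) * hrec k t
        simp_rw [this]
        rw [integral_add ((hi _).const_mul _) ((hi _).const_mul _), integral_const_mul,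
          integral_const_mul, ih, ih]
        simp
  have hmul : ∀ {ψ : ℝ → ℝ}, Continuous ψ →
      Integrable (fun t => f t * (φ 0 t * ψ t)) (volume.restrict (Ioo (0 : ℝ) T)) :=
    fun hψ => f.integrable_mul ((hc 0).mul hψ)
  have heval : ∀ p : Polynomial ℝ, Continuous fun t => p.eval (x t) := fun p =>
    p.continuous.comp hxc
  have hpoly : ∀ p : Polynomial ℝ, ∫ t in Ioo 0 T, f t * (φ 0 t * p.eval (x t)) = 0 := by
    intro p
    induction p using Polynomial.induction_on' with
    | add p q hp hq =>
      simp only [Polynomial.eval_add, mul_add]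
      rw [integral_add (hmul (heval p)) (hmul (heval q)), hp, hq, add_zero]
    | monomial n c =>
      have : ∀ t, f t * (φ 0 t * (Polynomial.monomial n c).eval (x t)) =
          c * (f t * (φ 0 t * x t ^ n)) := fun t => by
        rw [Polynomial.eval_monomial]
        ring
      simp_rw [this]
      rw [integral_const_mul, hpow, mul_zero]
  have hfφ := f.integrable_mul (hc 0)
  have key := ae_eq_zero_of_test hfφ fun ψ h1 _ _ => by
    -- `ψ` as a continuous function of `cos (π t / T)`
    have hcont : ContinuousOn (fun y => ψ (Real.arccos y * (T / Real.pi))) (Icc (-1) 1) :=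
      (h1.continuous.comp (Real.continuous_arccos.mul continuous_const)).continuousOn
    refine abs_eq_zero.mp (le_antisymm (le_of_forall_pos_le_add fun ε hε => ?_) (abs_nonneg _))
    set I := ∫ t in Ioo 0 T, ‖f t * φ 0 t‖ with hI
    have hI0 : 0 ≤ I := integral_nonneg fun t => norm_nonneg _
    obtain ⟨p, hp⟩ := exists_polynomial_near_of_continuousOn (-1) 1 _ hcont (ε / (I + 1))
      (by positivity)
    have hsub : ∫ t in Ioo 0 T, f t * φ 0 t * ψ t =
        ∫ t in Ioo 0 T, f t * (φ 0 t * (ψ t - p.eval (x t))) := by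
      simp only [mul_sub]
      rw [integral_sub (hmul h1.continuous) (hmul (heval p)), hpoly, sub_zero]
      simp only [mul_assoc]
    rw [hsub, ← Real.norm_eq_abs, zero_add]
    calc ‖∫ t in Ioo 0 T, f t * (φ 0 t * (ψ t - p.eval (x t)))‖
        ≤ ∫ t in Ioo 0 T, ε / (I + 1) * ‖f t * φ 0 t‖ := by
          refine norm_integral_le_of_norm_le (hfφ.norm.const_mul _) ?_
          filter_upwards [ae_restrict_mem measurableSet_Ioo] with t ht
          have harg : Real.pi / T * t ∈ Icc 0 Real.pi := by
            have := Real.pi_pos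
            have h2 := ht.1
            refine ⟨by positivity, ?_⟩
            rw [div_mul_eq_mul_div, div_le_iff₀ hT]
            exact mul_le_mul_of_nonneg_left ht.2.le this.le
          have h3 := hp (x t) (Real.cos_mem_Icc _)
          simp only [hx] at h3
          have h4 : Real.pi / T * t * (T / Real.pi) = t := by
            have := Real.pi_ne_zero
            field_simp
          rw [Real.arccos_cos harg.1 harg.2, h4, abs_sub_comm] at h3
          rw [← mul_assoc, norm_mul, mul_comm]
          exact mul_le_mul_of_nonneg_right h3.le (norm_nonneg _)
      _ = ε / (I + 1) * I := by rw [integral_const_mul]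
      _ ≤ ε := by
          rw [div_mul_eq_mul_div, div_le_iff₀ (by positivity)]
          nlinarith
  refine Lp.ext ?_
  filter_upwards [key, Lp.coeFn_zero ℝ 2 (volume.restrict (Ioo (0 : ℝ) T)),
    ae_restrict_mem measurableSet_Ioo] with t h1 h2 h3
  rw [h2]
  exact (mul_eq_zero.mp h1).resolve_right (hne t h3)

theorem L2I.eq_zero_of_trig {T : ℝ} (hT : 0 < T) (e : Endpoint) {f : L2I T}
    (hf : ∀ k, ∫ t in Ioo 0 T, f t * e.trig (freq T k * t) = 0) : f = 0 := by
  have hpi := Real.pi_pos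
  have hfreq : ∀ k t, freq T (k + 1) * t = freq T k * t + Real.pi / T * t := fun k t => by
    unfold freq; push_cast; ring
  have hhalf : ∀ t, Real.pi / T * t = 2 * (freq T 0 * t) := fun t => by
    unfold freq; push_cast; ring
  have hc : ∀ k, Continuous fun t => e.trig (freq T k * t) := fun k =>
    e.continuous_trig.comp (by fun_prop)
  have harg : ∀ t ∈ Ioo 0 T, freq T 0 * t ∈ Ioo 0 (Real.pi / 2) := fun t ht => by
    refine ⟨mul_pos (freq_pos hT 0) ht.1, ?_⟩
    have : freq T 0 * T = Real.pi / 2 := by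
      unfold freq; push_cast; field_simp; ring
    rw [← this]
    exact mul_lt_mul_of_pos_left ht.2 (freq_pos hT 0)
  have hrec : ∀ k t, 2 * Real.cos (Real.pi / T * t) * e.trig (freq T (k + 1) * t) =
      e.trig (freq T (k + 2) * t) + e.trig (freq T k * t) := by
    intro k t
    have h1 : freq T k * t = freq T (k + 1) * t - Real.pi / T * t := by rw [hfreq]; ring
    rw [hfreq (k + 1), h1]
    cases e
    · simp only [Endpoint.trig, Real.sin_add, Real.sin_sub]; ring
    · simp only [Endpoint.trig, Real.cos_add, Real.cos_sub]; ring
  have hne : ∀ t ∈ Ioo 0 T, e.trig (freq T 0 * t) ≠ 0 := by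
    intro t ht
    have h := harg t ht
    cases e
    · exact (Real.sin_pos_of_pos_of_lt_pi h.1 (by linarith [h.2])).ne'
    · exact (Real.cos_pos_of_mem_Ioo ⟨by linarith [h.1], h.2⟩).ne'
  -- the recurrence continued to `k = -1`, where the frequency is `-freq T 0`
  obtain ⟨r, hr⟩ : ∃ r : ℝ, ∀ t, 2 * Real.cos (Real.pi / T * t) * e.trig (freq T 0 * t) =
      e.trig (freq T 1 * t) + r * e.trig (freq T 0 * t) := by
    have h1 : ∀ t, freq T 1 * t = freq T 0 * t + 2 * (freq T 0 * t) := fun t => by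
      rw [← hhalf, ← hfreq]
    cases e
    · refine ⟨-1, fun t => ?_⟩
      simp only [Endpoint.trig, h1, hhalf, Real.sin_add, Real.cos_two_mul, Real.sin_two_mul]
      ring
    · refine ⟨1, fun t => ?_⟩
      simp only [Endpoint.trig, h1, hhalf, Real.cos_add, Real.cos_two_mul, Real.sin_two_mul]
      linear_combination (2 * Real.cos (freq T 0 * t)) * Real.sin_sq_add_cos_sq (freq T 0 * t)
  exact L2I.eq_zero_of_chebyshev hT hc hne hr hrec hf

theorem Endpoint.memLp_mode (T : ℝ) (e : Endpoint) (k : ℕ) :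
    MemLp (fun t => √(2 / T) * e.trig (freq T k * t)) 2 (volume.restrict (Ioo (0 : ℝ) T)) :=
  memLp_of_continuousOn
    (continuous_const.mul (e.continuous_trig.comp (continuous_const.mul continuous_id))).continuousOn

/-- The normalised sines (`e = initial`) resp. cosines (`e = final`) in `L²(0,T)`. -/
noncomputable def Endpoint.mode (T : ℝ) (e : Endpoint) (k : ℕ) : L2I T :=
  (e.memLp_mode T k).toLp _

theorem Endpoint.inner_mode {T : ℝ} (e : Endpoint) (k : ℕ) (u : L2I T) :
    ⟪e.mode T k, u⟫_ℝ = √(2 / T) * ∫ t in Ioo 0 T, u t * e.trig (freq T k * t) := by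
  rw [Endpoint.mode, L2I.inner_toLp, ← integral_const_mul]
  congr 1
  ext t
  ring

theorem Endpoint.orthonormal_mode {T : ℝ} (hT : 0 < T) (e : Endpoint) :
    Orthonormal ℝ (e.mode T) := by
  rw [orthonormal_iff_ite]
  intro m k
  rw [e.inner_mode]
  have : ∫ t in Ioo 0 T, e.mode T k t * e.trig (freq T m * t) =
      √(2 / T) * ∫ t in Ioo 0 T, e.trig (freq T m * t) * e.trig (freq T k * t) := by
    rw [← integral_const_mul]
    refine integral_congr_ae ((e.memLp_mode T k).coeFn_toLp.mono fun t ht => ?_)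
    simp only [Endpoint.mode, ht]
    ring
  rw [this, e.integral_trig_mul_trig hT, ← mul_assoc, Real.mul_self_sqrt (by positivity)]
  split_ifs
  · field_simp
  · simp

/-- The sines resp. cosines form a Hilbert basis of `L²(0,T)`. -/
noncomputable def Endpoint.basis {T : ℝ} (hT : 0 < T) (e : Endpoint) : HilbertBasis ℕ ℝ (L2I T) :=
  HilbertBasis.mkOfOrthogonalEqBot (e.orthonormal_mode hT) <| by
    refine (Submodule.eq_bot_iff _).mpr fun f hf => L2I.eq_zero_of_trig hT e fun k => ?_
    have h := (Submodule.mem_orthogonal _ _).mp hf _ (Submodule.subset_span (mem_range_self k))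
    rw [e.inner_mode] at h
    exact (mul_eq_zero.mp h).resolve_left (by positivity)

theorem Endpoint.basis_repr {T : ℝ} (hT : 0 < T) (e : Endpoint) (u : L2I T) (k : ℕ) :
    (e.basis hT).repr u k = √(2 / T) * ∫ t in Ioo 0 T, u t * e.trig (freq T k * t) := by
  rw [HilbertBasis.repr_apply_apply, Endpoint.basis, HilbertBasis.coe_mkOfOrthogonalEqBot,
    e.inner_mode]

theorem Endpoint.abs_sval {T : ℝ} (hT : 0 < T) (e : Endpoint) (k : ℕ) :
    |e.sval T k| = (freq T k)⁻¹ := by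
  have := inv_pos.mpr (freq_pos hT k)
  cases e <;> simp [Endpoint.sval, abs_of_pos (freq_pos hT k)]

theorem H1.repr_incl {T : ℝ} (hT : 0 < T) {e : Endpoint} (u : H1 T e) (k : ℕ) :
    (e.basis hT).repr (H1.incl T e u) k =
      e.sval T k * (e.opp.basis hT).repr (H1.derivEquiv hT e u) k := by
  rw [e.basis_repr, e.opp.basis_repr, H1.derivEquiv_apply,
    H1.integral_mul_deriv hT u (e.hasDerivAt_trig hT k)
      (e.continuous_trig.comp (continuous_const.mul continuous_id))
      (by rw [e.opp.trig_time hT, mul_zero])]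
  have : ∀ t, H1.weakDeriv T e u t * (-e.sval T k * e.opp.trig (freq T k * t)) =
      -e.sval T k * (H1.weakDeriv T e u t * e.opp.trig (freq T k * t)) := fun t => by ring
  simp_rw [this]
  rw [integral_const_mul]
  ring

/-- The embedding `H¹ ↪ L²` is diagonal in the sine and cosine bases. -/
theorem isDiagonal_incl {T : ℝ} (hT : 0 < T) (e : Endpoint) :
    HalfInterp.IsDiagonal (H1.incl T e) (e.basis hT)
      ((H1.derivEquiv hT e).trans (e.opp.basis hT).repr) (fun k => e.sval T k) where
  ne_zero k := by
    rw [← abs_pos, e.abs_sval hT]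
    exact inv_pos.mpr (freq_pos hT k)
  repr_apply u k := H1.repr_incl hT u k

end WaveBEM

/-! ### Interpolation of contractions -/

namespace HalfInterp

section

variable {X Y : Type*} [NormedAddCommGroup X] [NormedSpace ℝ X]
  [NormedAddCommGroup Y] [NormedSpace ℝ Y] {j : X →L[ℝ] Y}

theorem kFun_map_le {S : Y →ₗ[ℝ] Y} (hS : ∀ y, ‖S y‖ ≤ ‖y‖)
    (hX : ∀ x : X, ∃ x' : X, j x' = S (j x) ∧ ‖x'‖ ≤ ‖x‖) (s : ℝ) (y : Y) :
    kFun j s (S y) ≤ kFun j s y := by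
  refine le_ciInf fun x => ?_
  obtain ⟨x', h1, h2⟩ := hX x
  refine (kFun_le j s (S y) x').trans ?_
  rw [h1, ← map_sub]
  gcongr
  exact hS _

theorem kFun_map_div_le {S : Y →ₗ[ℝ] Y} (hS : ∀ y, ‖S y‖ ≤ ‖y‖)
    (hX : ∀ x : X, ∃ x' : X, j x' = S (j x) ∧ ‖x'‖ ≤ ‖x‖) (y : Y) {s : ℝ} (hs : s ∈ Ioi (0 : ℝ)) :
    kFun j s (S y) / s ≤ kFun j s y / s :=
  div_le_div_of_nonneg_right (kFun_map_le hS hX s y) (le_of_lt hs)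

theorem map_mem_halfSubmodule {S : Y →ₗ[ℝ] Y} (hS : ∀ y, ‖S y‖ ≤ ‖y‖)
    (hX : ∀ x : X, ∃ x' : X, j x' = S (j x) ∧ ‖x'‖ ≤ ‖x‖) {y : Y} (hy : y ∈ halfSubmodule j) :
    S y ∈ halfSubmodule j := by
  have hy' : MemLp (fun s => kFun j s y / s) 2 (volume.restrict (Ioi 0)) := hy
  refine hy'.mono (aestronglyMeasurable_kFun j _) ?_
  filter_upwards [ae_restrict_mem measurableSet_Ioi] with s hs
  have hs' : (0 : ℝ) < s := hs
  have h1 := kFun_nonneg j s y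
  have h2 := kFun_nonneg j s (S y)
  rw [Real.norm_of_nonneg (by positivity), Real.norm_of_nonneg (by positivity)]
  exact kFun_map_div_le hS hX y hs

/-- A contraction of `Y` that restricts to a contraction of `X` acts on `[X, Y]_{1/2}` as a
contraction. -/
noncomputable def HalfSpace.map (S : Y →ₗ[ℝ] Y) (hS : ∀ y, ‖S y‖ ≤ ‖y‖)
    (hX : ∀ x : X, ∃ x' : X, j x' = S (j x) ∧ ‖x'‖ ≤ ‖x‖) : HalfSpace j →L[ℝ] HalfSpace j :=
  LinearMap.mkContinuous
    (S.restrict (p := halfSubmodule j) (q := halfSubmodule j)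
      fun _ hy => map_mem_halfSubmodule hS hX hy : HalfSpace j →ₗ[ℝ] HalfSpace j) 1 fun y => by
    rw [one_mul, HalfSpace.norm_def, HalfSpace.norm_def]
    refine Real.sqrt_le_sqrt (mul_le_mul_of_nonneg_left ?_ (by positivity))
    refine integral_mono_of_nonneg (ae_of_all _ fun s => sq_nonneg _)
      (HalfSpace.memLp j y).integrable_sq ?_
    filter_upwards [ae_restrict_mem measurableSet_Ioi] with s hs
    have hs' : (0 : ℝ) < s := hs
    exact pow_le_pow_left₀ (div_nonneg (kFun_nonneg j s _) hs'.le)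
      (kFun_map_div_le hS hX (HalfSpace.toY j y) hs) 2

theorem HalfSpace.toY_injective (j : X →L[ℝ] Y) : Function.Injective (HalfSpace.toY j) :=
  (halfSubmodule j).injective_subtype

end

end HalfInterp

/-! ### The time shift -/

namespace WaveBEM

open HalfInterp

theorem zeroExt_of_mem {T t : ℝ} (z : ℝ → ℝ) (ht : t ∈ Ioo 0 T) : zeroExt T z t = z t :=
  indicator_of_mem ht z

theorem zeroExt_of_notMem {T t : ℝ} (z : ℝ → ℝ) (ht : t ∉ Ioo 0 T) : zeroExt T z t = 0 :=
  indicator_of_notMem ht z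

theorem ae_sub_right {p : ℝ → Prop} (L : ℝ) (h : ∀ᵐ t, p t) : ∀ᵐ t, p (t - L) :=
  (measurePreserving_sub_right volume L).quasiMeasurePreserving.ae h

theorem memLp_zeroExt {T : ℝ} (y : L2I T) : MemLp (zeroExt T y) 2 volume :=
  (memLp_indicator_iff_restrict measurableSet_Ioo).mpr (Lp.memLp y)

theorem memLp_zeroExt_sub {T : ℝ} (L : ℝ) (y : L2I T) :
    MemLp (fun t => zeroExt T y (t - L)) 2 (volume.restrict (Ioo (0 : ℝ) T)) :=
  ((memLp_zeroExt y).comp_measurePreserving (measurePreserving_sub_right volume L)).restrict _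

/-- The time shift `y ↦ y(· - L)` on `L²(0,T)`, the function `y` being extended by zero. -/
noncomputable def L2I.shift (T L : ℝ) : L2I T →ₗ[ℝ] L2I T where
  toFun y := (memLp_zeroExt_sub L y).toLp _
  map_add' y z := by
    rw [← MemLp.toLp_add]
    refine (MemLp.toLp_eq_toLp_iff _ _).mpr (ae_restrict_of_ae ?_)
    have h := (ae_restrict_iff' measurableSet_Ioo).mp (Lp.coeFn_add y z)
    filter_upwards [ae_sub_right L h] with t ht
    by_cases hm : t - L ∈ Ioo 0 T
    · change zeroExt T (y + z : L2I T) (t - L) = zeroExt T y (t - L) + zeroExt T z (t - L)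
      simp only [zeroExt_of_mem _ hm]
      exact ht hm
    · simp [zeroExt_of_notMem _ hm]
  map_smul' c y := by
    rw [RingHom.id_apply, ← MemLp.toLp_const_smul]
    refine (MemLp.toLp_eq_toLp_iff _ _).mpr (ae_restrict_of_ae ?_)
    have h := (ae_restrict_iff' measurableSet_Ioo).mp (Lp.coeFn_smul c y)
    filter_upwards [ae_sub_right L h] with t ht
    by_cases hm : t - L ∈ Ioo 0 T
    · simp [zeroExt_of_mem _ hm, ht hm]
    · simp [zeroExt_of_notMem _ hm]

theorem L2I.shift_ae_eq {T : ℝ} (L : ℝ) (y : L2I T) :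
    L2I.shift T L y =ᵐ[volume.restrict (Ioo (0 : ℝ) T)] fun t => zeroExt T y (t - L) :=
  (memLp_zeroExt_sub L y).coeFn_toLp

theorem L2I.norm_shift_le {T : ℝ} (L : ℝ) (y : L2I T) : ‖L2I.shift T L y‖ ≤ ‖y‖ := by
  change ‖(memLp_zeroExt_sub L y).toLp _‖ ≤ _
  rw [Lp.norm_toLp, Lp.norm_def]
  refine ENNReal.toReal_mono (Lp.eLpNorm_ne_top y) ?_
  refine (eLpNorm_mono_measure _ Measure.restrict_le_self).trans (le_of_eq ?_)
  exact (eLpNorm_comp_measurePreserving (memLp_zeroExt y).1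
    (measurePreserving_sub_right volume L)).trans
    (eLpNorm_indicator_eq_eLpNorm_restrict measurableSet_Ioo)

theorem integral_zeroExt_of_nonpos {T a b : ℝ} (y : ℝ → ℝ) (ha : a ≤ 0) (hb : b ≤ 0) :
    ∫ s in a..b, zeroExt T y s = 0 := by
  refine intervalIntegral.integral_zero_ae (ae_of_all _ fun s hs => ?_)
  refine zeroExt_of_notMem _ fun hm => ?_
  exact (hm.1.trans_le hs.2).not_ge (max_le ha hb)

theorem integral_zeroExt_of_mem {T t : ℝ} (y : ℝ → ℝ) (ht : t ∈ Ioo 0 T) :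
    ∫ s in (0 : ℝ)..t, zeroExt T y s = ∫ s in (0 : ℝ)..t, y s := by
  refine intervalIntegral.integral_congr_ae (ae_of_all _ fun s hs => ?_)
  rw [uIoc_of_le ht.1.le] at hs
  exact zeroExt_of_mem _ ⟨hs.1, hs.2.trans_lt ht.2⟩

theorem H1.incl_ae_eq_zeroExt {T : ℝ} (hT : 0 < T) (u : H1 T .initial) :
    H1.incl T .initial u =ᵐ[volume.restrict (Ioo (0 : ℝ) T)]
      fun t => ∫ s in (0 : ℝ)..t, zeroExt T (H1.weakDeriv T .initial u) s := by
  filter_upwards [H1.incl_ae_eq hT u, ae_restrict_mem measurableSet_Ioo] with t h1 h2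
  rw [h1, integral_zeroExt_of_mem _ h2]
  rfl

theorem H1.shift_incl_ae_eq {T L : ℝ} (hT : 0 < T) (hL : 0 < L) (u : H1 T .initial) :
    L2I.shift T L (H1.incl T .initial u) =ᵐ[volume.restrict (Ioo (0 : ℝ) T)]
      fun t => ∫ s in (0 : ℝ)..(t - L), zeroExt T (H1.weakDeriv T .initial u) s := by
  have h := (ae_restrict_iff' measurableSet_Ioo).mp (H1.incl_ae_eq_zeroExt hT u)
  filter_upwards [L2I.shift_ae_eq L (H1.incl T .initial u), ae_restrict_of_ae (ae_sub_right L h),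
    ae_restrict_mem measurableSet_Ioo] with t h1 h2 h3
  rw [h1]
  by_cases hm : t - L ∈ Ioo 0 T
  · rw [zeroExt_of_mem _ hm, h2 hm]
  · rw [zeroExt_of_notMem _ hm, integral_zeroExt_of_nonpos _ le_rfl]
    by_contra! hlt
    exact hm ⟨hlt, by linarith [h3.2]⟩

/-- The shift commutes with the antiderivative, because functions in `H¹_{0,}(0,T)` stay continuous
when they are extended by zero to the left. -/
theorem H1.shift_incl {T L : ℝ} (hT : 0 < T) (hL : 0 < L) (u : H1 T .initial) :
    L2I.shift T L (H1.incl T .initial u) = H1.incl T .initial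
      ((H1.derivEquiv hT .initial).symm (L2I.shift T L (H1.weakDeriv T .initial u))) := by
  set g := H1.weakDeriv T .initial u
  set v := (H1.derivEquiv hT .initial).symm (L2I.shift T L g) with hv
  have hvd : H1.weakDeriv T .initial v = L2I.shift T L g := by
    rw [← H1.derivEquiv_apply hT, hv, LinearIsometryEquiv.apply_symm_apply]
  have hi : ∀ a b, IntervalIntegrable (zeroExt T g) volume a b := fun a b =>
    ((integrable_indicator_iff measurableSet_Ioo).mpr g.integrable).intervalIntegrable
  refine Lp.ext ?_
  filter_upwards [H1.shift_incl_ae_eq hT hL u, H1.incl_ae_eq hT v,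
    ae_restrict_mem measurableSet_Ioo] with t h1 h2 h3
  rw [h1, h2, hvd]
  have h4 : ∫ s in (0 : ℝ)..t, L2I.shift T L g s = ∫ s in (0 : ℝ)..t, zeroExt T g (s - L) := by
    refine intervalIntegral.integral_congr_ae ?_
    have h := (ae_restrict_iff' measurableSet_Ioo).mp (L2I.shift_ae_eq L g)
    filter_upwards [h] with s hs hs'
    rw [uIoc_of_le h3.1.le] at hs'
    exact hs ⟨hs'.1, hs'.2.trans_lt h3.2⟩
  change _ = ∫ s in (0 : ℝ)..t, L2I.shift T L g s
  rw [h4, intervalIntegral.integral_comp_sub_right (fun s => zeroExt T g s),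
    ← intervalIntegral.integral_add_adjacent_intervals (hi (0 - L) 0) (hi 0 (t - L)),
    integral_zeroExt_of_nonpos _ (by linarith) le_rfl, zero_add]

/-- The time shift on `H^{1/2}_{0,}(0,T)`. -/
noncomputable def HHalf.shift {T L : ℝ} (hT : 0 < T) (hL : 0 < L) :
    HHalf T .initial →L[ℝ] HHalf T .initial :=
  HalfSpace.map (L2I.shift T L) (L2I.norm_shift_le L) fun u =>
    ⟨_, (H1.shift_incl hT hL u).symm, by
      rw [LinearIsometryEquiv.norm_map]
      exact L2I.norm_shift_le L _⟩

theorem HHalf.toY_shift {T L : ℝ} (hT : 0 < T) (hL : 0 < L) (y : HHalf T .initial) :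
    HalfSpace.toY _ (HHalf.shift hT hL y) = L2I.shift T L (HalfSpace.toY _ y) := rfl

/-- The function `y` vanishes on `(0, a)`. -/
def VanishesBefore (T a : ℝ) (y : L2I T) : Prop :=
  ∀ᵐ t ∂volume.restrict (Ioo (0 : ℝ) T), t < a → y t = 0

theorem VanishesBefore.shift {T a : ℝ} {y : L2I T} (h : VanishesBefore T a y) (L : ℝ) :
    VanishesBefore T (a + L) (L2I.shift T L y) := by
  have h' := (ae_restrict_iff' measurableSet_Ioo).mp h
  filter_upwards [L2I.shift_ae_eq L y, ae_restrict_of_ae (ae_sub_right L h')] with t h1 h2 h3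
  rw [h1]
  by_cases hm : t - L ∈ Ioo 0 T
  · rw [zeroExt_of_mem _ hm, h2 hm (by linarith)]
  · exact zeroExt_of_notMem _ hm

theorem VanishesBefore.eq_zero {T a : ℝ} {y : L2I T} (h : VanishesBefore T a y) (ha : T ≤ a) :
    y = 0 := by
  refine Lp.ext ?_
  filter_upwards [h, Lp.coeFn_zero ℝ 2 (volume.restrict (Ioo (0 : ℝ) T)),
    ae_restrict_mem measurableSet_Ioo] with t h1 h2 h3
  rw [h1 (h3.2.trans_le ha), h2]
  rfl

/-- The delayed crosstalk `(z_0, z_L) ↦ (z_L(· - L), z_0(· - L))` on `H^{1/2}_{0,}(Σ)`. -/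
noncomputable def HHalfSigma.crosstalk {T L : ℝ} (hT : 0 < T) (hL : 0 < L) :
    HHalfSigma T .initial →L[ℝ] HHalfSigma T .initial :=
  (WithLp.prodContinuousLinearEquiv 2 ℝ _ _).symm.toContinuousLinearMap ∘L
    ((HHalf.shift hT hL ∘L ContinuousLinearMap.snd ℝ _ _).prod
      (HHalf.shift hT hL ∘L ContinuousLinearMap.fst ℝ _ _)) ∘L
    (WithLp.prodContinuousLinearEquiv 2 ℝ _ _).toContinuousLinearMap

theorem HHalfSigma.crosstalk_fst {T L : ℝ} (hT : 0 < T) (hL : 0 < L) (z : HHalfSigma T .initial) :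
    (HHalfSigma.crosstalk hT hL z).fst = HHalf.shift hT hL z.snd := rfl

theorem HHalfSigma.crosstalk_snd {T L : ℝ} (hT : 0 < T) (hL : 0 < L) (z : HHalfSigma T .initial) :
    (HHalfSigma.crosstalk hT hL z).snd = HHalf.shift hT hL z.fst := rfl

theorem HHalfSigma.ext {T : ℝ} {e : Endpoint} {y z : HHalfSigma T e} (h1 : y.fst = z.fst)
    (h2 : y.snd = z.snd) : y = z :=
  WithLp.ofLp_injective 2 (Prod.ext h1 h2)

/-- Each application delays by `L`, so after time `T` nothing is left. -/
theorem HHalfSigma.isNilpotent_crosstalk {T L : ℝ} (hT : 0 < T) (hL : 0 < L) :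
    IsNilpotent (HHalfSigma.crosstalk hT hL) := by
  have key : ∀ (n : ℕ) (z : HHalfSigma T .initial),
      VanishesBefore T (n * L) (HalfSpace.toY _ ((HHalfSigma.crosstalk hT hL ^ n) z).fst) ∧
      VanishesBefore T (n * L) (HalfSpace.toY _ ((HHalfSigma.crosstalk hT hL ^ n) z).snd) := by
    intro n z
    induction n with
    | zero =>
      constructor <;>
      · filter_upwards [ae_restrict_mem measurableSet_Ioo] with t ht ht'
        rw [Nat.cast_zero, zero_mul] at ht'
        exact absurd ht' ht.1.not_gt
    | succ n ih =>
      rw [pow_succ', mul_apply_eq_comp, HHalfSigma.crosstalk_fst,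
        HHalfSigma.crosstalk_snd, HHalf.toY_shift, HHalf.toY_shift, Nat.cast_succ, add_one_mul]
      exact ⟨ih.2.shift L, ih.1.shift L⟩
  obtain ⟨n, hn⟩ := exists_nat_ge (T / L)
  rw [div_le_iff₀ hL] at hn
  refine ⟨n, ContinuousLinearMap.ext fun z => HHalfSigma.ext ?_ ?_⟩
  · exact HalfSpace.toY_injective _ (((key n z).1.eq_zero hn).trans (map_zero _).symm)
  · exact HalfSpace.toY_injective _ (((key n z).2.eq_zero hn).trans (map_zero _).symm)

end WaveBEM

/-! ### The antiderivative between the interpolation spaces -/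

namespace HalfInterp

open scoped lp InnerProductSpace

variable {ι X Y : Type*} [Countable ι] [NormedAddCommGroup X] [NormedSpace ℝ X]
  [NormedAddCommGroup Y] [InnerProductSpace ℝ Y] {j : X →L[ℝ] Y} {b : HilbertBasis ι ℝ Y}
  {a : X ≃ₗᵢ[ℝ] ℓ²(ι, ℝ)} {ρ : ι → ℝ}

theorem IsDiagonal.map_mem_halfSubmodule (h : IsDiagonal j b a ρ) (x : X) :
    j x ∈ halfSubmodule j := by
  refine h.mem_halfSubmodule.mpr ?_
  refine ((hasSum_sq_lp (a x)).summable.mul_left ‖j‖).of_nonneg_of_le (fun k => by positivity)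
    fun k => ?_
  have h0 := abs_pos.mpr (h.ne_zero k)
  rw [h.repr_apply, mul_pow, ← sq_abs (ρ k), div_le_iff₀ h0]
  have := mul_le_mul_of_nonneg_right (h.abs_le k) (mul_nonneg h0.le (sq_nonneg (a x k)))
  nlinarith

/-- The inclusion `X ⊆ [X, Y]_{1/2}`. -/
def IsDiagonal.ofX (h : IsDiagonal j b a ρ) (x : X) : HalfSpace j :=
  ⟨j x, h.map_mem_halfSubmodule x⟩

theorem IsDiagonal.toY_ofX (h : IsDiagonal j b a ρ) (x : X) : HalfSpace.toY j (h.ofX x) = j x := rfl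

theorem IsDiagonal.equivLp_ofX (h : IsDiagonal j b a ρ) (x : X) {k : ι} (hk : 0 < ρ k) :
    h.equivLp (h.ofX x) k = √|ρ k| * a x k := by
  have h1 := h.repr_toY (h.ofX x) k
  have h0 := Real.sqrt_pos.mpr (abs_pos.mpr hk.ne')
  rw [h.toY_ofX, h.repr_apply] at h1
  refine mul_left_cancel₀ h0.ne' ?_
  rw [← h1, ← mul_assoc, Real.mul_self_sqrt (abs_nonneg _), abs_of_pos hk]

end HalfInterp

namespace WaveBEM

open HalfInterp
open scoped lp InnerProductSpace

/-- Coordinates of `H^{1/2}(0,T)` for either endpoint condition. -/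
noncomputable abbrev HHalf.coord {T : ℝ} (hT : 0 < T) (e : Endpoint) : HHalf T e ≃ₗᵢ[ℝ] ℓ²(ℕ, ℝ) :=
  (isDiagonal_incl hT e).equivLp

/-- The antiderivative `w ↦ ∫_0^t w` as a map from `L²(0,T)` to `H^{1/2}_{0,}(0,T)`. -/
noncomputable def HHalf.primitive {T : ℝ} (hT : 0 < T) (w : L2I T) : HHalf T .initial :=
  (isDiagonal_incl hT .initial).ofX ((H1.derivEquiv hT .initial).symm w)

/-- In coordinates, the antiderivative of `w` represents the functional `v ↦ ⟨w, v⟩` on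
`H^{1/2}_{,0}(0,T)`: the sine coefficients of the former and the cosine coefficients of the latter
carry the same weights. -/
theorem HHalf.inner_coord_primitive {T : ℝ} (hT : 0 < T) (w : L2I T) (v : HHalf T .final) :
    ⟪HHalf.coord hT .initial (HHalf.primitive hT w), HHalf.coord hT .final v⟫_ℝ =
      ⟪w, HalfSpace.toY _ v⟫_ℝ := by
  set b := Endpoint.final.basis hT
  have h1 := lp.hasSum_inner (𝕜 := ℝ) (b.repr w) (b.repr (HalfSpace.toY _ v))
  rw [LinearIsometryEquiv.inner_map_map] at h1
  refine (lp.hasSum_inner (𝕜 := ℝ) _ _).unique (h1.congr_fun fun k => ?_)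
  have h2 : HHalf.coord hT .initial (HHalf.primitive hT w) k =
      √|Endpoint.initial.sval T k| * b.repr w k := by
    refine ((isDiagonal_incl hT .initial).equivLp_ofX _
      (inv_pos.mpr (freq_pos hT k))).trans ?_
    simp only [LinearIsometryEquiv.trans_apply, LinearIsometryEquiv.apply_symm_apply]
    rfl
  have h3 := (isDiagonal_incl hT .final).repr_toY v k
  rw [h2, h3, Endpoint.abs_sval hT, Endpoint.abs_sval hT]
  exact (real_inner_smul_left _ _ _).trans (real_inner_smul_right _ _ _).symm

/-- The space of coordinates for functions on `Σ`. -/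
abbrev CoordSigma : Type := WithLp 2 (ℓ²(ℕ, ℝ) × ℓ²(ℕ, ℝ))

/-- Coordinates of `H^{1/2}(Σ)` for either endpoint condition. -/
noncomputable def HHalfSigma.coord {T : ℝ} (hT : 0 < T) (e : Endpoint) :
    HHalfSigma T e ≃ₗᵢ[ℝ] CoordSigma :=
  LinearIsometryEquiv.withLpProdCongr 2 (HHalf.coord hT e) (HHalf.coord hT e)

/-- The Riesz isomorphism of a real Hilbert space, as a linear map over the identity of `ℝ`. -/
noncomputable def riesz (E : Type*) [NormedAddCommGroup E] [InnerProductSpace ℝ E]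
    [CompleteSpace E] : E ≃ₗᵢ[ℝ] StrongDual ℝ E where
  toFun := InnerProductSpace.toDual ℝ E
  invFun := (InnerProductSpace.toDual ℝ E).symm
  left_inv := (InnerProductSpace.toDual ℝ E).symm_apply_apply
  right_inv := (InnerProductSpace.toDual ℝ E).apply_symm_apply
  map_add' := map_add _
  map_smul' c x := by simp
  norm_map' := (InnerProductSpace.toDual ℝ E).norm_map

/-- The antiderivative on both boundary components, as an isomorphism from the dual of
`H^{1/2}_{,0}(Σ)` onto `H^{1/2}_{0,}(Σ)`: in coordinates it is the inverse Riesz isomorphism. -/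
noncomputable def HHalfSigma.primitive {T : ℝ} (hT : 0 < T) :
    StrongDual ℝ (HHalfSigma T .final) ≃L[ℝ] HHalfSigma T .initial :=
  ((HHalfSigma.coord hT .final).toContinuousLinearEquiv.arrowCongr
    (ContinuousLinearEquiv.refl ℝ ℝ)).trans
    ((riesz CoordSigma).symm.trans (HHalfSigma.coord hT .initial).symm).toContinuousLinearEquiv

theorem HHalfSigma.primitive_toDual {T : ℝ} (hT : 0 < T) (w : L2Sigma T) :
    HHalfSigma.primitive hT (L2Sigma.toDual T .final w) =
      WithLp.toLp 2 (HHalf.primitive hT w.fst, HHalf.primitive hT w.snd) := by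
  set y : HHalfSigma T .initial :=
    WithLp.toLp 2 (HHalf.primitive hT w.fst, HHalf.primitive hT w.snd)
  have h : riesz CoordSigma (HHalfSigma.coord hT .initial y) =
      L2Sigma.toDual T .final w ∘L
        (HHalfSigma.coord hT .final).symm.toContinuousLinearEquiv.toContinuousLinearMap := by
    ext z
    obtain ⟨v, rfl⟩ := (HHalfSigma.coord hT .final).surjective z
    have hv : (HHalfSigma.coord hT .final).symm (HHalfSigma.coord hT .final v) = v :=
      LinearIsometryEquiv.symm_apply_apply _ v
    change ⟪HHalfSigma.coord hT .initial y, HHalfSigma.coord hT .final v⟫_ℝ =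
      ⟪w, HHalfSigma.incl T .final
        ((HHalfSigma.coord hT .final).symm (HHalfSigma.coord hT .final v))⟫_ℝ
    rw [hv, WithLp.prod_inner_apply, WithLp.prod_inner_apply]
    exact congrArg₂ (· + ·) (HHalf.inner_coord_primitive hT w.fst v.fst)
      (HHalf.inner_coord_primitive hT w.snd v.snd)
  change (HHalfSigma.coord hT .initial).symm ((riesz CoordSigma).symm
    (L2Sigma.toDual T .final w ∘L
      (HHalfSigma.coord hT .final).symm.toContinuousLinearEquiv.toContinuousLinearMap)) = y
  rw [← h, LinearIsometryEquiv.symm_apply_apply, LinearIsometryEquiv.symm_apply_apply]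

theorem HHalfSigma.incl_injective (T : ℝ) (e : Endpoint) :
    Function.Injective (HHalfSigma.incl T e) := fun _ _ h =>
  HHalfSigma.ext (HalfSpace.toY_injective _ (congrArg WithLp.fst h))
    (HalfSpace.toY_injective _ (congrArg WithLp.snd h))

/-- `L²(Σ)` is dense in the dual of `H^{1/2}(Σ)`: in coordinates, the embedding is the adjoint of
an injective operator. -/
theorem L2Sigma.denseRange_toDual {T : ℝ} (hT : 0 < T) (e : Endpoint) :
    DenseRange (L2Sigma.toDual T e) := by
  set P := HHalfSigma.coord hT e
  let G : CoordSigma →L[ℝ] L2Sigma T :=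
    HHalfSigma.incl T e ∘L P.symm.toContinuousLinearEquiv.toContinuousLinearMap
  have hG : Function.Injective G := (HHalfSigma.incl_injective T e).comp P.symm.injective
  have hd : DenseRange (ContinuousLinearMap.adjoint G) := by
    have h1 : (ContinuousLinearMap.adjoint G).rangeᗮ = ⊥ := by
      rw [ContinuousLinearMap.orthogonal_range, ContinuousLinearMap.adjoint_adjoint]
      exact LinearMap.ker_eq_bot.mpr hG
    have h2 := (Submodule.topologicalClosure_eq_top_iff (𝕜 := ℝ)).mpr h1
    exact (Submodule.dense_iff_topologicalClosure_eq_top).mpr h2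
  let R : CoordSigma ≃L[ℝ] StrongDual ℝ (HHalfSigma T e) :=
    (riesz CoordSigma).toContinuousLinearEquiv.trans
      (P.symm.toContinuousLinearEquiv.arrowCongr (ContinuousLinearEquiv.refl ℝ ℝ))
  have hR : L2Sigma.toDual T e = R ∘ ContinuousLinearMap.adjoint G := by
    funext w
    ext v
    have hv : P.symm (P v) = v := P.symm_apply_apply v
    change ⟪w, HHalfSigma.incl T e v⟫_ℝ = ⟪ContinuousLinearMap.adjoint G w, P v⟫_ℝ
    rw [ContinuousLinearMap.adjoint_inner_left]
    change _ = ⟪w, HHalfSigma.incl T e (P.symm (P v))⟫_ℝ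
    rw [hv]
  rw [hR]
  exact R.surjective.denseRange.comp hd R.continuous

/-! ### The single layer operator -/

/-- The operator `½ (1 + crosstalk)`, invertible because the crosstalk is nilpotent. -/
theorem HHalfSigma.exists_equiv_crosstalk {T L : ℝ} (hT : 0 < T) (hL : 0 < L) :
    ∃ M : HHalfSigma T .initial ≃L[ℝ] HHalfSigma T .initial,
      ∀ z, M z = (1 / 2 : ℝ) • (z + HHalfSigma.crosstalk hT hL z) := by
  have hu : IsUnit (algebraMap ℝ (HHalfSigma T .initial →L[ℝ] HHalfSigma T .initial) (1 / 2) *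
      (1 + HHalfSigma.crosstalk hT hL)) :=
    ((IsUnit.mk0 (1 / 2 : ℝ) (by norm_num)).map _).mul
      (HHalfSigma.isNilpotent_crosstalk hT hL).isUnit_one_add
  obtain ⟨u, hu⟩ := hu
  refine ⟨ContinuousLinearEquiv.unitsEquiv ℝ _ u, fun z => ?_⟩
  rw [ContinuousLinearEquiv.unitsEquiv_apply, hu]
  rfl

theorem isSingleLayerOf_primitive {T L : ℝ} (hT : 0 < T) (hL : 0 < L) (w : L2Sigma T)
    {y : HHalfSigma T .initial}
    (hy : y = WithLp.toLp 2 (HHalf.primitive hT w.fst, HHalf.primitive hT w.snd)) :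
    IsSingleLayerOf L T w (HHalfSigma.incl T .initial
      ((1 / 2 : ℝ) • (y + HHalfSigma.crosstalk hT hL y))) := by
  subst hy
  have hd : ∀ u : L2I T, H1.weakDeriv T .initial ((H1.derivEquiv hT .initial).symm u) = u :=
    fun u => (H1.derivEquiv hT .initial).apply_symm_apply u
  have key : ∀ p q : L2I T,
      ((1 / 2 : ℝ) • (H1.incl T .initial ((H1.derivEquiv hT .initial).symm p) +
        L2I.shift T L (H1.incl T .initial ((H1.derivEquiv hT .initial).symm q))) : L2I T)
      =ᵐ[volume.restrict (Ioo (0 : ℝ) T)] fun t => 1 / 2 * (∫ s in (0 : ℝ)..t, zeroExt T p s) +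
        1 / 2 * ∫ s in (0 : ℝ)..(t - L), zeroExt T q s := by
    intro p q
    have h1 := H1.incl_ae_eq_zeroExt hT ((H1.derivEquiv hT .initial).symm p)
    have h2 := H1.shift_incl_ae_eq hT hL ((H1.derivEquiv hT .initial).symm q)
    rw [hd] at h1 h2
    filter_upwards [h1, h2, Lp.coeFn_smul (1 / 2 : ℝ)
      (H1.incl T .initial ((H1.derivEquiv hT .initial).symm p) +
        L2I.shift T L (H1.incl T .initial ((H1.derivEquiv hT .initial).symm q))),
      Lp.coeFn_add (H1.incl T .initial ((H1.derivEquiv hT .initial).symm p))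
        (L2I.shift T L (H1.incl T .initial ((H1.derivEquiv hT .initial).symm q)))] with t e1 e2 e3 e4
    rw [e3, Pi.smul_apply, e4, Pi.add_apply, e1, e2, smul_eq_mul, mul_add]
  refine ⟨key w.fst w.snd, ?_⟩
  refine (key w.snd w.fst).trans (ae_of_all _ fun t => ?_)
  exact add_comm _ _

theorem IsSingleLayerOf.unique {L T : ℝ} {w y z : L2Sigma T} (hy : IsSingleLayerOf L T w y)
    (hz : IsSingleLayerOf L T w z) : y = z :=
  WithLp.ofLp_injective 2
    (Prod.ext (Lp.ext (hy.1.trans hz.1.symm)) (Lp.ext (hy.2.trans hz.2.symm)))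

/-- An isomorphism `V` from a normed space onto a normed space `F` is inf-sup stable with respect
to the duality pairing on `F`. -/
theorem exists_inf_sup {E F : Type*} [NormedAddCommGroup E] [NormedSpace ℝ E]
    [NormedAddCommGroup F] [NormedSpace ℝ F] (V : E ≃L[ℝ] F) :
    ∃ c : ℝ, 0 < c ∧ ∀ w : E,
      c * ‖w‖ ≤ ⨆ v : {v : StrongDual ℝ F // v ≠ 0}, |v.1 (V w)| / ‖v.1‖ := by
  set C := ‖(V.symm : F →L[ℝ] E)‖ + 1
  have hC : 0 < C := by positivity
  refine ⟨C⁻¹, inv_pos.mpr hC, fun w => ?_⟩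
  have h1 : C⁻¹ * ‖w‖ ≤ ‖V w‖ := by
    rw [inv_mul_le_iff₀ hC]
    calc ‖w‖ = ‖(V.symm : F →L[ℝ] E) (V w)‖ := by simp
      _ ≤ ‖(V.symm : F →L[ℝ] E)‖ * ‖V w‖ := ContinuousLinearMap.le_opNorm _ _
      _ ≤ C * ‖V w‖ := by gcongr; simp [C]
  refine h1.trans ?_
  have hbdd : BddAbove (range fun v : {v : StrongDual ℝ F // v ≠ 0} => |v.1 (V w)| / ‖v.1‖) := by
    refine ⟨‖V w‖, ?_⟩
    rintro _ ⟨v, rfl⟩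
    refine div_le_of_le_mul₀ (norm_nonneg _) (norm_nonneg _) ?_
    rw [mul_comm]
    exact v.1.le_opNorm (V w)
  rcases eq_or_ne (V w) 0 with h0 | h0
  · rw [h0, norm_zero]
    exact Real.iSup_nonneg fun v => by positivity
  · obtain ⟨g, hg, hgw⟩ := exists_dual_vector ℝ (V w) (norm_ne_zero_iff.mpr h0)
    have hg0 : g ≠ 0 := by
      rintro rfl
      simp at hg
    refine le_trans (le_of_eq ?_) (le_ciSup hbdd ⟨g, hg0⟩)
    simp only [hg, hgw, div_one]
    simp

end WaveBEM

theorem mainTheorem4 (L T : ℝ) (hL : 0 < L) (hT : 0 < T) :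
    ∃ V : StrongDual ℝ (WaveBEM.HHalfSigma T .final) ≃L[ℝ] WaveBEM.HHalfSigma T .initial,
      (∀ w : WaveBEM.L2Sigma T, WaveBEM.IsSingleLayerOf L T w
        (WaveBEM.HHalfSigma.incl T .initial (V (WaveBEM.L2Sigma.toDual T .final w)))) ∧
      (∀ V' : StrongDual ℝ (WaveBEM.HHalfSigma T .final) →L[ℝ] WaveBEM.HHalfSigma T .initial,
        (∀ w : WaveBEM.L2Sigma T, WaveBEM.IsSingleLayerOf L T w
          (WaveBEM.HHalfSigma.incl T .initial (V' (WaveBEM.L2Sigma.toDual T .final w)))) →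
        ∀ w, V' w = V w) ∧
      ∃ c_S : ℝ, 0 < c_S ∧ ∀ w : StrongDual ℝ (WaveBEM.HHalfSigma T .final),
        c_S * ‖w‖ ≤
          ⨆ v : {v : StrongDual ℝ (WaveBEM.HHalfSigma T .initial) // v ≠ 0},
            |v.1 (V w)| / ‖v.1‖ := by
  obtain ⟨M, hM⟩ := WaveBEM.HHalfSigma.exists_equiv_crosstalk hT hL
  have hV : ∀ w : WaveBEM.L2Sigma T, WaveBEM.IsSingleLayerOf L T w
      (WaveBEM.HHalfSigma.incl T .initial
        (((WaveBEM.HHalfSigma.primitive hT).trans M) (WaveBEM.L2Sigma.toDual T .final w))) := by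
    intro w
    rw [ContinuousLinearEquiv.trans_apply, hM]
    exact WaveBEM.isSingleLayerOf_primitive hT hL w (WaveBEM.HHalfSigma.primitive_toDual hT w)
  refine ⟨(WaveBEM.HHalfSigma.primitive hT).trans M, hV, fun V' hV' w => ?_,
    WaveBEM.exists_inf_sup _⟩
  refine congrFun ((WaveBEM.L2Sigma.denseRange_toDual hT .final).equalizer V'.continuous
    ((WaveBEM.HHalfSigma.primitive hT).trans M).continuous (funext fun u => ?_)) w
  exact WaveBEM.HHalfSigma.incl_injective T .initial ((hV' u).unique (hV u))
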